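/- Let $Z_1,Z_2,\dots$ be i.i.d. copies of $Z$, $\mathcal D_n=\{Z_i\}_{i=1}^n$, and let $m(z,\theta)$ be a real function with $\theta$ in a compact set $\Theta\subset\mathbb R^d$, twice continuously differentiable in $\theta$ (in a neighbourhood of $\Theta$), with gradient $\dot m$ and Hessian $\ddot m$ with respect to $\theta$. Let $M_n(\theta)=\frac1n\sum_{i=1}^n m(Z_i,\theta)$, $\ddot M_n(\theta)=\frac1n\sum_{i=1}^n\ddot m(Z_i,\theta)$, and $\hat\theta_n=\arg\max_{\theta\in\Theta}M_n(\theta)$ (any measurable choice of a maximizer). Let $s_n<n$ and let $\pi_{n,i}>0$, $i=1,\dots,n$, be functions of $\mathcal D_n$ with $\sum_{i=1}^n\pi_{n,i}=1$ and $s_n\pi_{n,i}\le1$. In Poisson subsampling, $u_1,\dots,u_n$ are i.i.d. $U(0,1)$, independent of $\mathcal D_n$, the observation $Z_i$ is selected if and only if $u_i\le s_n\pi_{n,i}$, and with $S$ the set of selected indices and $s_n^*=|S|$, $$\tilde\theta_{s_n,P}=\arg\max_{\theta\in\Theta}\sum_{i\in S}\frac{m(Z_i,\theta)}{n s_n^*\pi_{n,i}}$$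 (any measurable choice of a maximizer). Assume: 1. $\Theta$ is compact. 2. For every $z$, $m(z,\cdot)$ is concave (on the convex hull of $\Theta$); $E\,m^2(Z,\theta)<\infty$ for all $\theta\in\Theta$; and $\theta\mapsto E\,m(Z,\theta)$ has a unique maximizer $\theta_0$ over $\Theta$, which is an interior point of $\Theta$. 3. $-E\,\ddot m(Z,\theta_0)$ is positive definite, $E\,\ddot m_{k,l}^2(Z,\theta)<\infty$ for all $\theta\in\Theta$ and all $k,l$, and there is a function $\psi$ with $E\,\psi^2(Z)<\infty$ and $|\ddot m_{k,l}(z,\theta_1)-\ddot m_{k,l}(z,\theta_2)|\le\psi(z)\|\theta_1-\theta_2\|$ for all $z$, all $\theta_1,\theta_2\in\Theta$ and all $k,l$. 4. $\Lambda(\theta_0)=E\{\dot m(Z,\theta_0)\dot m^{T}(Z,\theta_0)\}$ is finite and positive definite, and $\frac1n\sum_{i=1}^n\|\dot m(Z_i,\hat\theta_n)\|^4=O_P(1)$. 5. $\max_{1\le i\le n}(n\pi_{n,i})^{-1}=O_P(1)$. Let $$\Lambda_{n,R}(\theta)=\frac1{n^2}\sum_{i=1}^n\frac{\dot m(Z_i,\theta)\dot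 m^{T}(Z_i,\theta)}{\pi_{n,i}},\qquad \Lambda_{n,P}(\theta)=\Lambda_{n,R}(\theta)-\frac{s_n}{n^2}\sum_{i=1}^n\dot m(Z_i,\theta)\dot m^{T}(Z_i,\theta),$$ $V_{n,R}(\theta)=\ddot M_n^{-1}(\theta)\Lambda_{n,R}(\theta)\ddot M_n^{-1}(\theta)$ and $V_{n,P}(\theta)=\ddot M_n^{-1}(\theta)\Lambda_{n,P}(\theta)\ddot M_n^{-1}(\theta)$. Assume that $\Lambda_{n,P}(\hat\theta_n)$ does not degenerate asymptotically: its smallest eigenvalue is bounded away from zero in probability (for every $\varepsilon>0$ there is $c>0$ such that, for all large $n$, $\Lambda_{n,P}(\hat\theta_n)\ge c\,I$ with probability at least $1-\varepsilon$). Then, as $n\to\infty$ and $s_n\to\infty$: (a) $\sqrt{s_n}\,\{V_{n,P}(\hat\theta_n)\}^{-1/2}(\tilde\theta_{s_n,P}-\hat\theta_n)$ converges in conditional distribution to $N(0,I_d)$ given $\mathcal D_n$ in probability: for every $x\in\mathbb R^d$, with $U\sim N(0,I_d)$ and componentwise inequalities, $$\Pr\big(\sqrt{s_n}\{V_{n,P}(\hat\theta_n)\}^{-1/2}(\tilde\theta_{s_n,P}-\hat\theta_n)\le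 x\,\big|\,\mathcal D_n\big)-\Pr(U\le x)\to0\quad\text{in probability.}$$ (b) The variance is smaller than that of sampling with replacement: always $\Lambda_{n,P}(\theta)\le\Lambda_{n,R}(\theta)$ and $V_{n,P}(\theta)\le V_{n,R}(\theta)$ in the Loewner order for $\theta\in\Theta$ (where a singular $\ddot M_n(\theta)$ is given the inverse $0$ by convention), and with probability tending to one $V_{n,P}(\hat\theta_n)$ and $V_{n,R}(\hat\theta_n)-V_{n,P}(\hat\theta_n)$ are positive definite. -/

import Mathlib

open Filter Topology MeasureTheory ProbabilityTheory

/-- The gradient `ṁ(θ)` of `f : ℝᵈ → ℝ` at `θ`, as the vector of partial derivatives. -/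
noncomputable def grad {d : ℕ} (f : EuclideanSpace ℝ (Fin d) → ℝ)
    (θ : EuclideanSpace ℝ (Fin d)) : Fin d → ℝ :=
  fun k => fderiv ℝ f θ (EuclideanSpace.single k 1)

/-- The Hessian `m̈(θ)` of `f : ℝᵈ → ℝ` at `θ`, as the matrix of second partial derivatives. -/
noncomputable def hess {d : ℕ} (f : EuclideanSpace ℝ (Fin d) → ℝ)
    (θ : EuclideanSpace ℝ (Fin d)) : Matrix (Fin d) (Fin d) ℝ :=
  Matrix.of fun k l => fderiv ℝ (fun η => grad f η k) θ (EuclideanSpace.single l 1)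

/-- The full-data objective `M_n(θ) = n⁻¹ ∑ᵢ m(zᵢ, θ)`. -/
noncomputable def fullObj {𝒵 : Type*} {d : ℕ} (m : 𝒵 → EuclideanSpace ℝ (Fin d) → ℝ) {n : ℕ}
    (z : Fin n → 𝒵) (θ : EuclideanSpace ℝ (Fin d)) : ℝ :=
  (n : ℝ)⁻¹ * ∑ i, m (z i) θ

/-- The Poisson subsample objective `∑_{i ∈ S} m(zᵢ, θ) / (n s* πᵢ)`, where `S` is the set of
selected indices and `s* = |S|` is the realized subsample size. -/
noncomputable def subObj {𝒵 : Type*} {d : ℕ} (m : 𝒵 → EuclideanSpace ℝ (Fin d) → ℝ) {n : ℕ}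
    (z : Fin n → 𝒵) (p : Fin n → ℝ) (S : Finset (Fin n)) (θ : EuclideanSpace ℝ (Fin d)) : ℝ :=
  ∑ i ∈ S, m (z i) θ / ((n : ℝ) * (S.card : ℝ) * p i)

/-- Poisson selection: index `i` is included if and only if `uᵢ ≤ s πᵢ`. -/
noncomputable def poissonSelect {n : ℕ} (s : ℝ) (p : Fin n → ℝ) (u : Fin n → ℝ) :
    Finset (Fin n) :=
  open Classical in Finset.univ.filter fun i => u i ≤ s * p i

/-- The law of `n` independent `U(0,1)` random variables. -/
noncomputable def uniformLaw (n : ℕ) : Measure (Fin n → ℝ) :=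
  Measure.pi fun _ : Fin n => (volume : Measure ℝ).restrict (Set.Ioo 0 1)

/-- The conditional probability, given the data, that the Poisson subsample (with expected size
`s` and subsampling probabilities `p`, which are functions of the data) has the property `A`.
The uniform variables that drive the selection are independent of the data, so that given the
data they still have the law `uniformLaw n`. -/
noncomputable def condProb {n : ℕ} (s : ℝ) (p : Fin n → ℝ) (A : Set (Finset (Fin n))) : ℝ :=
  (uniformLaw n).real {u | poissonSelect s p u ∈ A}

/-- `M̈_n(θ) = n⁻¹ ∑ᵢ m̈(zᵢ, θ)`. -/
noncomputable def hessN {𝒵 : Type*} {d : ℕ} (m : 𝒵 → EuclideanSpace ℝ (Fin d) → ℝ) {n : ℕ}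
    (z : Fin n → 𝒵) (θ : EuclideanSpace ℝ (Fin d)) : Matrix (Fin d) (Fin d) ℝ :=
  (n : ℝ)⁻¹ • ∑ i, hess (m (z i)) θ

/-- `Λ_{n,R}(θ) = n⁻² ∑ᵢ ṁ(zᵢ, θ) ṁ(zᵢ, θ)ᵀ / πᵢ`. -/
noncomputable def lamR {𝒵 : Type*} {d : ℕ} (m : 𝒵 → EuclideanSpace ℝ (Fin d) → ℝ) {n : ℕ}
    (z : Fin n → 𝒵) (p : Fin n → ℝ) (θ : EuclideanSpace ℝ (Fin d)) :
    Matrix (Fin d) (Fin d) ℝ :=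
  ((n : ℝ) ^ 2)⁻¹ • ∑ i, (p i)⁻¹ • Matrix.vecMulVec (grad (m (z i)) θ) (grad (m (z i)) θ)

/-- `Λ_{n,P}(θ) = Λ_{n,R}(θ) - (s / n²) ∑ᵢ ṁ(zᵢ, θ) ṁ(zᵢ, θ)ᵀ`. -/
noncomputable def lamP {𝒵 : Type*} {d : ℕ} (m : 𝒵 → EuclideanSpace ℝ (Fin d) → ℝ) {n : ℕ}
    (s : ℝ) (z : Fin n → 𝒵) (p : Fin n → ℝ) (θ : EuclideanSpace ℝ (Fin d)) :
    Matrix (Fin d) (Fin d) ℝ :=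
  lamR m z p θ -
    (s / (n : ℝ) ^ 2) • ∑ i, Matrix.vecMulVec (grad (m (z i)) θ) (grad (m (z i)) θ)

/-- `V_{n,R}(θ) = M̈_n(θ)⁻¹ Λ_{n,R}(θ) M̈_n(θ)⁻¹`. -/
noncomputable def varR {𝒵 : Type*} {d : ℕ} (m : 𝒵 → EuclideanSpace ℝ (Fin d) → ℝ) {n : ℕ}
    (z : Fin n → 𝒵) (p : Fin n → ℝ) (θ : EuclideanSpace ℝ (Fin d)) :
    Matrix (Fin d) (Fin d) ℝ :=
  (hessN m z θ)⁻¹ * lamR m z p θ * (hessN m z θ)⁻¹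

/-- `V_{n,P}(θ) = M̈_n(θ)⁻¹ Λ_{n,P}(θ) M̈_n(θ)⁻¹`. -/
noncomputable def varP {𝒵 : Type*} {d : ℕ} (m : 𝒵 → EuclideanSpace ℝ (Fin d) → ℝ) {n : ℕ}
    (s : ℝ) (z : Fin n → 𝒵) (p : Fin n → ℝ) (θ : EuclideanSpace ℝ (Fin d)) :
    Matrix (Fin d) (Fin d) ℝ :=
  (hessN m z θ)⁻¹ * lamP m s z p θ * (hessN m z θ)⁻¹

/-- `A^{-1/2}` for a symmetric positive definite matrix `A`, through the functional calculus:
the function `x ↦ x^{-1/2}` is applied to the eigenvalues of `A`. -/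
noncomputable def invSqrt {d : ℕ} (A : Matrix (Fin d) (Fin d) ℝ) : Matrix (Fin d) (Fin d) ℝ :=
  cfc (fun x : ℝ => (Real.sqrt x)⁻¹) A

/-- The normalized error `√s V_{n,P}(θ̂)^{-1/2} (θ̃ - θ̂)`. -/
noncomputable def normErr {𝒵 : Type*} {d : ℕ} (m : 𝒵 → EuclideanSpace ℝ (Fin d) → ℝ) {n : ℕ}
    (s : ℝ) (z : Fin n → 𝒵) (p : Fin n → ℝ) (θhat θtil : EuclideanSpace ℝ (Fin d)) :
    Fin d → ℝ :=
  Real.sqrt s • (invSqrt (varP m s z p θhat)).mulVec (fun k => θtil k - θhat k)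

/-- The full data `D_n = (Z_1, …, Z_n)`. -/
def dataSet {Ω 𝒵 : Type*} (Z : ℕ → Ω → 𝒵) (n : ℕ) (ω : Ω) : Fin n → 𝒵 :=
  fun i => Z i ω

/-- `X_n = O_P(1)`. -/
def BoundedInProb {Ω : Type*} [MeasurableSpace Ω] (P : Measure Ω) (X : ℕ → Ω → ℝ) : Prop :=
  ∀ ε : ℝ, 0 < ε → ∃ K : ℝ, ∀ᶠ n in atTop, P {ω | K < |X n ω|} ≤ ENNReal.ofReal ε

/-- The smallest eigenvalue of the symmetric random matrix `A_n` is bounded away from zero in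
probability (in the Loewner order: `A_n ≥ c I`), that is, `‖A_n⁻¹‖ = O_P(1)` with
`A_n` positive definite. -/
def BoundedBelowInProb {Ω : Type*} [MeasurableSpace Ω] {d : ℕ} (P : Measure Ω)
    (A : ℕ → Ω → Matrix (Fin d) (Fin d) ℝ) : Prop :=
  ∀ ε : ℝ, 0 < ε → ∃ c : ℝ, 0 < c ∧ ∀ᶠ n in atTop,
    P {ω | ¬ (A n ω - c • (1 : Matrix (Fin d) (Fin d) ℝ)).PosSemidef} ≤ ENNReal.ofReal ε

/-!
# Conditional asymptotic normality of the Poisson subsampling estimator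

Given the data, everything is random only through the independent selection indicators `δᵢ`, which
are Bernoulli with parameters `s πᵢ`. After multiplication by `|S| / s`, which does not change the
maximizers, the subsample objective is the inverse-probability weighted sum
`∑ᵢ δᵢ m(zᵢ, θ) / (n s πᵢ)`, whose gradient at `θhat` has conditional mean `0` (the full-data
first-order condition) and conditional covariance exactly `Λ_{n,P}(θhat) / s`.

*Linearization.* For a concave objective with a Lipschitz Hessian, a maximizer over `Θ` is close to
any interior point `a` at which the Hessian is negative definite and the gradient is small
(`norm_sub_lt_of_isMaxOn`). It then solves the first-order equation, and the Taylor formula for the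
gradient gives the Newton step with a quadratic remainder (`newton_expansion_of_isMaxOn`). This is
used twice: at `θ₀` for the full data, where it yields the consistency of `θhat`, and at `θhat` for
the subsample, where Chebyshev's inequality for inverse-probability weighted sums controls the
gradient and the Hessian (`uniformLaw_bad_le`).

*Normality.* With `B = V^{-1/2} H⁻¹` and `H` the full-data Hessian, `B Λ_{n,P} Bᵀ = 1`
(`standardize_mul_mul_transpose`), so the linear term of the normalized error is a sum of
independent centred variables with identity covariance, and the two-point laws are compared with the
Gaussian one by Lyapunov's bound (`norm_integral_cexp_linear_sub_le`). All bounds depend on the data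
only through the constants of `RegularSample`. A form of Lévy's continuity theorem that is uniform
over a class of laws (`orthant_tendsto_of_charFun`) therefore turns them into a bound for the
conditional probabilities of orthants, uniform over all regular samples (`condProb_tendsto`).

*Regularity.* The law of large numbers, the consistency of `θhat` and the assumed bounds in
probability (fourth gradient moment, inclusion weights, `Λ_{n,P}`) show that the sample is regular
with probability arbitrarily close to one (`regularSample_in_probability`).

*Comparison of variances.* `Λ_{n,R} - Λ_{n,P}` is `s / n²` times a sum of matrices `ṁ ṁᵀ`, hence
positive semidefinite. It is definite whenever `Λ_{n,P}` is, because a vector orthogonal to all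
gradients lies in the kernel of `Λ_{n,P}`.
-/

/-! ### Calculus: gradients, Hessians and maximizers of concave functions -/

section Calculus

variable {d : ℕ}

theorem EuclideanSpace.abs_apply_le (v : EuclideanSpace ℝ (Fin d)) (k : Fin d) : |v k| ≤ ‖v‖ :=
  PiLp.norm_apply_le v k

theorem EuclideanSpace.norm_le_sum_abs (v : EuclideanSpace ℝ (Fin d)) : ‖v‖ ≤ ∑ k, |v k| := by
  rw [EuclideanSpace.norm_eq]
  apply Real.sqrt_le_iff.2 ⟨Finset.sum_nonneg fun k _ => abs_nonneg _, ?_⟩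
  simp only [Real.norm_eq_abs]
  exact Finset.sum_sq_le_sq_sum_of_nonneg fun k _ => abs_nonneg _

theorem abs_sum_mul_le {a : Fin d → ℝ} {γ : ℝ} (h : ∀ k, |a k| ≤ γ)
    (v : EuclideanSpace ℝ (Fin d)) : |∑ k, a k * v k| ≤ d * γ * ‖v‖ := by
  calc |∑ k, a k * v k| ≤ ∑ k, |a k * v k| := Finset.abs_sum_le_sum_abs _ _
    _ ≤ ∑ _k : Fin d, γ * ‖v‖ := by
        refine Finset.sum_le_sum fun k _ => ?_
        rw [abs_mul]
        have := EuclideanSpace.abs_apply_le v k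
        have := h k
        have := abs_nonneg (a k)
        gcongr
        linarith
    _ = d * γ * ‖v‖ := by simp [mul_assoc]

theorem clm_apply_eq_sum (φ : EuclideanSpace ℝ (Fin d) →L[ℝ] ℝ) (v : EuclideanSpace ℝ (Fin d)) :
    φ v = ∑ k, φ (EuclideanSpace.single k 1) * v k := by
  conv_lhs => rw [← (EuclideanSpace.basisFun (Fin d) ℝ).sum_repr v]
  simp [map_sum, mul_comm]

theorem clm_norm_le {φ : EuclideanSpace ℝ (Fin d) →L[ℝ] ℝ} {γ : ℝ} (hγ : 0 ≤ γ)
    (h : ∀ k, |φ (EuclideanSpace.single k 1)| ≤ γ) : ‖φ‖ ≤ d * γ := by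
  refine φ.opNorm_le_bound (by positivity) fun v => ?_
  rw [clm_apply_eq_sum, Real.norm_eq_abs]
  exact abs_sum_mul_le h v

theorem fderiv_apply_eq_grad (f : EuclideanSpace ℝ (Fin d) → ℝ) (a v : EuclideanSpace ℝ (Fin d)) :
    fderiv ℝ f a v = ∑ k, grad f a k * v k :=
  clm_apply_eq_sum _ v

theorem ContDiffAt.differentiableAt_grad {f : EuclideanSpace ℝ (Fin d) → ℝ}
    {a : EuclideanSpace ℝ (Fin d)} (hf : ContDiffAt ℝ 2 f a) (k : Fin d) :
    DifferentiableAt ℝ (fun η => grad f η k) a := by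
  have h : ContDiffAt ℝ 1 (fderiv ℝ f) a := hf.fderiv_right (by norm_num)
  exact (h.differentiableAt (by norm_num)).clm_apply (differentiableAt_const _)

theorem ContDiffAt.hess_eq {f : EuclideanSpace ℝ (Fin d) → ℝ}
    {a : EuclideanSpace ℝ (Fin d)} (hf : ContDiffAt ℝ 2 f a) (k l : Fin d) :
    hess f a k l =
      fderiv ℝ (fderiv ℝ f) a (EuclideanSpace.single l 1) (EuclideanSpace.single k 1) := by
  have h : ContDiffAt ℝ 1 (fderiv ℝ f) a := hf.fderiv_right (by norm_num)
  have h' := h.differentiableAt (by norm_num)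
  simp only [hess, grad, Matrix.of_apply]
  rw [fderiv_clm_apply h' (differentiableAt_const _)]
  simp

theorem ContDiffAt.hess_isHermitian {f : EuclideanSpace ℝ (Fin d) → ℝ}
    {a : EuclideanSpace ℝ (Fin d)} (hf : ContDiffAt ℝ 2 f a) : (hess f a).IsHermitian := by
  ext k l
  rw [Matrix.conjTranspose_apply, hf.hess_eq, hf.hess_eq]
  exact (hf.isSymmSndFDerivAt (by simp)) _ _

/-- The gradient of a weighted sum of functions that are differentiable at `a`. -/
theorem grad_sum {ι : Type*} (t : Finset ι) (w : ι → ℝ)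
    (f : ι → EuclideanSpace ℝ (Fin d) → ℝ) {a : EuclideanSpace ℝ (Fin d)}
    (hf : ∀ i ∈ t, DifferentiableAt ℝ (f i) a) (k : Fin d) :
    grad (fun θ => ∑ i ∈ t, w i * f i θ) a k = ∑ i ∈ t, w i * grad (f i) a k := by
  have : HasFDerivAt (fun θ => ∑ i ∈ t, w i * f i θ) (∑ i ∈ t, w i • fderiv ℝ (f i) a) a :=
    HasFDerivAt.fun_sum fun i hi => ((hf i hi).hasFDerivAt.const_mul (w i))
  simp [grad, this.fderiv]

theorem hess_sum {ι : Type*} (t : Finset ι) (w : ι → ℝ)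
    (f : ι → EuclideanSpace ℝ (Fin d) → ℝ) {a : EuclideanSpace ℝ (Fin d)}
    (hf : ∀ i ∈ t, ContDiffAt ℝ 2 (f i) a) (k l : Fin d) :
    hess (fun θ => ∑ i ∈ t, w i * f i θ) a k l = ∑ i ∈ t, w i * hess (f i) a k l := by
  have hev : (fun η => grad (fun θ => ∑ i ∈ t, w i * f i θ) η k) =ᶠ[𝓝 a]
      fun η => ∑ i ∈ t, w i * grad (f i) η k := by
    have : ∀ᶠ η in 𝓝 a, ∀ i ∈ t, ContDiffAt ℝ 2 (f i) η :=
      (Finset.eventually_all t).2 fun i hi => (hf i hi).eventually (by simp)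
    filter_upwards [this] with η hη
    exact grad_sum t w f (fun i hi => (hη i hi).differentiableAt (by norm_num)) k
  have : HasFDerivAt (fun η => ∑ i ∈ t, w i * grad (f i) η k)
      (∑ i ∈ t, w i • fderiv ℝ (fun η => grad (f i) η k) a) a :=
    HasFDerivAt.fun_sum fun i hi =>
      (((hf i hi).differentiableAt_grad k).hasFDerivAt.const_mul (w i))
  simp [hess, hev.fderiv_eq, this.fderiv]

/-- Taylor's formula for the gradient, with a quadratic remainder that comes from the Lipschitz
bound for the Hessian. -/
theorem abs_grad_sub_le {f : EuclideanSpace ℝ (Fin d) → ℝ} {a b : EuclideanSpace ℝ (Fin d)}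
    {L : ℝ} (hL : 0 ≤ L) (hf : ∀ η ∈ Metric.closedBall a ‖b - a‖, ContDiffAt ℝ 2 f η)
    (hlip : ∀ η ∈ Metric.closedBall a ‖b - a‖, ∀ k l, |hess f η k l - hess f a k l| ≤ L * ‖η - a‖)
    (k : Fin d) :
    |grad f b k - grad f a k - ∑ l, hess f a k l * (b - a) l| ≤ d * L * ‖b - a‖ ^ 2 := by
  have key := Convex.norm_image_sub_le_of_norm_hasFDerivWithin_le'
    (f := fun η => grad f η k) (f' := fun η => fderiv ℝ (fun η => grad f η k) η)
    (φ := fderiv ℝ (fun η => grad f η k) a) (s := Metric.closedBall a ‖b - a‖) (x := a) (y := b)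
    (C := d * (L * ‖b - a‖))
    (fun η hη => ((hf η hη).differentiableAt_grad k).hasFDerivAt.hasFDerivWithinAt)
    (fun η hη => ?_) (convex_closedBall _ _) (by simp) (by simp [dist_eq_norm])
  · rw [Real.norm_eq_abs, clm_apply_eq_sum] at key
    calc _ ≤ _ := key
      _ = _ := by ring
  · refine clm_norm_le (by positivity) fun l => ?_
    have h1 := hlip η hη k l
    have h2 : ‖η - a‖ ≤ ‖b - a‖ := by simpa [dist_eq_norm] using hη
    calc _ ≤ L * ‖η - a‖ := h1
      _ ≤ _ := by gcongr

/-- A first-order Taylor bound. -/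
theorem abs_sub_sub_grad_le {f : EuclideanSpace ℝ (Fin d) → ℝ} {a b : EuclideanSpace ℝ (Fin d)}
    {C : ℝ} (hC : 0 ≤ C) (hf : ∀ η ∈ Metric.closedBall a ‖b - a‖, DifferentiableAt ℝ f η)
    (hg : ∀ η ∈ Metric.closedBall a ‖b - a‖, ∀ k, |grad f η k - grad f a k| ≤ C) :
    |f b - f a - ∑ k, grad f a k * (b - a) k| ≤ d * C * ‖b - a‖ := by
  have key := Convex.norm_image_sub_le_of_norm_hasFDerivWithin_le'
    (f := f) (f' := fun η => fderiv ℝ f η)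
    (φ := fderiv ℝ f a) (s := Metric.closedBall a ‖b - a‖) (x := a) (y := b)
    (C := d * C)
    (fun η hη => (hf η hη).hasFDerivAt.hasFDerivWithinAt)
    (fun η hη => clm_norm_le hC (hg η hη)) (convex_closedBall _ _) (by simp)
    (by simp [dist_eq_norm])
  rwa [Real.norm_eq_abs, clm_apply_eq_sum] at key

/-- If a concave function attains at `b` its maximum over `Θ`, then at any point `c` of `Θ` its
derivative in the direction of `b` is nonnegative. -/
theorem ConcaveOn.fderiv_nonneg_of_isMaxOn {Θ : Set (EuclideanSpace ℝ (Fin d))}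
    {f : EuclideanSpace ℝ (Fin d) → ℝ} (hf : ConcaveOn ℝ (convexHull ℝ Θ) f)
    {b c : EuclideanSpace ℝ (Fin d)} (hb : b ∈ Θ) (hmax : IsMaxOn f Θ b) (hc : c ∈ Θ)
    (hd : DifferentiableAt ℝ f c) : 0 ≤ fderiv ℝ f c (b - c) := by
  have hmin : IsMinOn f (segment ℝ c b) c := by
    intro y hy
    have := hf.ge_on_segment (subset_convexHull ℝ Θ hc) (subset_convexHull ℝ Θ hb) hy
    rwa [min_eq_left (hmax hc)] at this
  exact (hmin.localize).hasFDerivWithinAt_nonneg hd.hasFDerivAt.hasFDerivWithinAt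
    (mem_posTangentConeAt_of_segment_subset (by simp))

theorem fderiv_eq_zero_of_isMaxOn {Θ : Set (EuclideanSpace ℝ (Fin d))}
    {f : EuclideanSpace ℝ (Fin d) → ℝ} {a b : EuclideanSpace ℝ (Fin d)} {r : ℝ}
    (hball : Metric.closedBall a r ⊆ Θ) (hba : ‖b - a‖ < r) (hmax : IsMaxOn f Θ b) :
    fderiv ℝ f b = 0 := by
  have : Θ ∈ 𝓝 b := mem_of_superset
    (Metric.isOpen_ball.mem_nhds (by simpa [dist_eq_norm] using hba : b ∈ Metric.ball a r))
    (Metric.ball_subset_closedBall.trans hball)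
  exact (hmax.isLocalMax this).fderiv_eq_zero

/-- The localization lemma for maximizers of concave functions: if the Hessian at `a` is at most
`-lam` and the gradient at `a` is small, then every maximizer over `Θ` lies close to `a`. -/
theorem norm_sub_lt_of_isMaxOn {Θ : Set (EuclideanSpace ℝ (Fin d))}
    {f : EuclideanSpace ℝ (Fin d) → ℝ} (hconc : ConcaveOn ℝ (convexHull ℝ Θ) f)
    (hf : ∀ η ∈ Θ, ContDiffAt ℝ 2 f η)
    {a b : EuclideanSpace ℝ (Fin d)} {r L lam γ ρ : ℝ} (hball : Metric.closedBall a r ⊆ Θ)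
    (hL : 0 ≤ L)
    (hlip : ∀ η ∈ Metric.closedBall a r, ∀ k l, |hess f η k l - hess f a k l| ≤ L * ‖η - a‖)
    (hb : b ∈ Θ) (hmax : IsMaxOn f Θ b)
    (hH : ∀ v : EuclideanSpace ℝ (Fin d), ∑ k, (∑ l, hess f a k l * v l) * v k ≤ -(lam * ‖v‖ ^ 2))
    (hg : ∀ k, |grad f a k| ≤ γ) (hρ : 0 < ρ) (hρr : ρ < r)
    (h1 : 2 * (d * γ) < lam * ρ) (h2 : 2 * (d ^ 2 * L * ρ) ≤ lam) : ‖b - a‖ < ρ := by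
  by_contra! hcon
  have hpos : 0 < ‖b - a‖ := hρ.trans_le hcon
  -- the point `c` at distance `ρ` from `a` on the segment from `a` to `b`
  set τ : ℝ := ρ / ‖b - a‖ with hτ
  have hτ0 : 0 < τ := by positivity
  have hτ1 : τ ≤ 1 := (div_le_one hpos).2 hcon
  set c := a + τ • (b - a) with hc
  have hca : c - a = τ • (b - a) := by simp [hc]
  have hcan : ‖c - a‖ = ρ := by
    rw [hca, norm_smul, Real.norm_eq_abs, abs_of_pos hτ0, hτ]; field_simp
  have hcb : b - c = (1 - τ) • (b - a) := by rw [hc, sub_smul, one_smul]; abel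
  have hcball : c ∈ Metric.closedBall a r := by simpa [dist_eq_norm, hcan] using hρr.le
  have hcΘ : c ∈ Θ := hball hcball
  have hsub : Metric.closedBall a ‖c - a‖ ⊆ Metric.closedBall a r :=
    Metric.closedBall_subset_closedBall (hcan.le.trans hρr.le)
  have hT := abs_grad_sub_le hL (fun η hη => hf η (hball (hsub hη))) (fun η hη => hlip η (hsub hη))
  -- the derivative at `c` in the direction `c - a` is negative
  have hneg : ∑ k, grad f c k * (c - a) k < 0 := by
    have e : ∑ k, grad f c k * (c - a) k = ∑ k, grad f a k * (c - a) k
        + ∑ k, (∑ l, hess f a k l * (c - a) l) * (c - a) k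
        + ∑ k, (grad f c k - grad f a k - ∑ l, hess f a k l * (c - a) l) * (c - a) k := by
      rw [← Finset.sum_add_distrib, ← Finset.sum_add_distrib]
      exact Finset.sum_congr rfl fun k _ => by ring
    have e1 := (le_abs_self _).trans (abs_sum_mul_le hg (c - a))
    have e2 := hH (c - a)
    have e3 := (le_abs_self _).trans (abs_sum_mul_le hT (c - a))
    rw [hcan] at e1 e2 e3
    rw [e]
    nlinarith [mul_le_mul_of_nonneg_right h2 (sq_nonneg ρ), mul_lt_mul_of_pos_right h1 hρ]
  rw [← fderiv_apply_eq_grad, hca, map_smul, smul_eq_mul] at hneg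
  rcases hτ1.eq_or_lt with h | h
  · have hcb' : c = b := by rw [hc, h]; simp
    rw [hcb', fderiv_eq_zero_of_isMaxOn hball (by rw [← hcb', hcan]; exact hρr) hmax] at hneg
    simp at hneg
  · have h0 := hconc.fderiv_nonneg_of_isMaxOn hb hmax hcΘ ((hf c hcΘ).differentiableAt (by norm_num))
    rw [hcb, map_smul, smul_eq_mul] at h0
    nlinarith [nonneg_of_mul_nonneg_right h0 (sub_pos.2 h)]

/-- The first and second order expansion of a maximizer `b` near `a`: its distance to `a` is of the
order of the gradient at `a`, and the Newton step `b - a ≈ -(hess f a)⁻¹ (grad f a)` is accurate up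
to a quadratic remainder. -/
theorem newton_expansion_of_isMaxOn {Θ : Set (EuclideanSpace ℝ (Fin d))}
    {f : EuclideanSpace ℝ (Fin d) → ℝ}
    (hf : ∀ η ∈ Θ, ContDiffAt ℝ 2 f η)
    {a b : EuclideanSpace ℝ (Fin d)} {r L lam γ ρ : ℝ} (hball : Metric.closedBall a r ⊆ Θ)
    (hL : 0 ≤ L)
    (hlip : ∀ η ∈ Metric.closedBall a r, ∀ k l, |hess f η k l - hess f a k l| ≤ L * ‖η - a‖)
    (hmax : IsMaxOn f Θ b)
    (hH : ∀ v : EuclideanSpace ℝ (Fin d), ∑ k, (∑ l, hess f a k l * v l) * v k ≤ -(lam * ‖v‖ ^ 2))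
    (hg : ∀ k, |grad f a k| ≤ γ) (hρr : ρ < r)
    (h2 : 2 * (d ^ 2 * L * ρ) ≤ lam) (hba : ‖b - a‖ < ρ) :
    lam * ‖b - a‖ ≤ 2 * (d * γ) ∧
      ∀ k, |grad f a k + ∑ l, hess f a k l * (b - a) l| ≤ d * L * ‖b - a‖ ^ 2 := by
  have hsub : Metric.closedBall a ‖b - a‖ ⊆ Metric.closedBall a r :=
    Metric.closedBall_subset_closedBall (hba.trans hρr).le
  have hT := abs_grad_sub_le hL (fun η hη => hf η (hball (hsub hη))) (fun η hη => hlip η (hsub hη))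
  have hz : ∀ k, grad f b k = 0 := fun k => by
    rw [grad, fderiv_eq_zero_of_isMaxOn hball (hba.trans hρr) hmax]; rfl
  have hT' : ∀ k, |grad f a k + ∑ l, hess f a k l * (b - a) l| ≤ d * L * ‖b - a‖ ^ 2 := fun k => by
    have := hT k
    rw [hz, ← abs_neg] at this
    convert this using 2
    ring
  refine ⟨?_, hT'⟩
  have e : ∑ k, (∑ l, hess f a k l * (b - a) l) * (b - a) k =
      ∑ k, (grad f a k + ∑ l, hess f a k l * (b - a) l) * (b - a) k
        - ∑ k, grad f a k * (b - a) k := by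
    rw [← Finset.sum_sub_distrib]
    exact Finset.sum_congr rfl fun k _ => by ring
  have e1 := (neg_abs_le _).trans' (neg_le_neg (abs_sum_mul_le hT' (b - a)))
  have e2 := (le_abs_self _).trans (abs_sum_mul_le hg (b - a))
  have e3 := hH (b - a)
  rw [e] at e3
  rcases (norm_nonneg (b - a)).eq_or_lt with h | h
  · rw [← h] at *
    rcases Nat.eq_zero_or_pos d with hd | hd
    · simp [hd]
    · have := (abs_nonneg _).trans (hg ⟨0, hd⟩)
      simp only [mul_zero]
      positivity
  · have e4 : 2 * (d ^ 2 * L * ‖b - a‖) ≤ lam := h2.trans' (by gcongr)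
    nlinarith [mul_le_mul_of_nonneg_right e4 (sq_nonneg ‖b - a‖)]

end Calculus

/-! ### Uniform Lévy continuity and the characteristic function of Bernoulli variables -/

section Levy

variable {d : ℕ}

/-- Orthants are continuity sets of the standard Gaussian law. -/
theorem stdGaussian_frontier_orthant (x : Fin d → ℝ) :
    stdGaussian (EuclideanSpace ℝ (Fin d)) (frontier {y | ∀ k, y k ≤ x k}) = 0 := by
  have hsub : frontier {y : EuclideanSpace ℝ (Fin d) | ∀ k, y k ≤ x k} ⊆
      ⋃ k, (fun y : EuclideanSpace ℝ (Fin d) => y k) ⁻¹' {x k} := by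
    intro y hy
    have hcl : IsClosed {y : EuclideanSpace ℝ (Fin d) | ∀ k, y k ≤ x k} := by
      simp only [Set.ofPred_forall]
      exact isClosed_iInter fun k => isClosed_le (by fun_prop) (by fun_prop)
    have hop : IsOpen {y : EuclideanSpace ℝ (Fin d) | ∀ k, y k < x k} := by
      simp only [Set.ofPred_forall]
      exact isOpen_iInter_of_finite fun k => isOpen_lt (by fun_prop) (by fun_prop)
    rw [hcl.frontier_eq] at hy
    by_contra hcon
    simp only [Set.mem_iUnion, Set.mem_preimage, Set.mem_singleton_iff, not_exists] at hcon
    exact hy.2 (interior_maximal (fun z hz k => (hz k).le) hop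
      (fun k => lt_of_le_of_ne (hy.1 k) (hcon k)))
  refine measure_mono_null hsub (measure_iUnion_null fun k => ?_)
  rw [← multivariateGaussian_zero_one]
  have h := measurePreserving_eval_multivariateGaussian (μ := (0 : EuclideanSpace ℝ (Fin d)))
    (S := (1 : Matrix (Fin d) (Fin d) ℝ)) Matrix.PosSemidef.one (i := k)
  rw [h.measure_preimage (measurableSet_singleton _).nullMeasurableSet]
  have := nullSingletonClass_gaussianReal (μ := (0 : EuclideanSpace ℝ (Fin d)) k)
    (v := ((1 : Matrix (Fin d) (Fin d) ℝ) k k).toNNReal) (by simp)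
  exact measure_singleton _

/-- A uniform form of Lévy's continuity theorem: if the characteristic functions of the laws in the
class `𝒞 s` approach, for every argument, the one of the standard Gaussian law as `s → ∞`, uniformly
over the class, then so do the probabilities of every orthant. -/
theorem orthant_tendsto_of_charFun (𝒞 : ℝ → Set (Measure (EuclideanSpace ℝ (Fin d))))
    (hprob : ∀ s, ∀ μ ∈ 𝒞 s, IsProbabilityMeasure μ)
    (h : ∀ t, ∀ ε : ℝ, 0 < ε → ∃ N : ℝ, ∀ s, N ≤ s → ∀ μ ∈ 𝒞 s,
      ‖charFun μ t - charFun (stdGaussian (EuclideanSpace ℝ (Fin d))) t‖ ≤ ε)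
    (x : Fin d → ℝ) {δ : ℝ} (hδ : 0 < δ) :
    ∃ N : ℝ, ∀ s, N ≤ s → ∀ μ ∈ 𝒞 s, |μ.real {y | ∀ k, y k ≤ x k} -
      (stdGaussian (EuclideanSpace ℝ (Fin d))).real {y | ∀ k, y k ≤ x k}| < δ := by
  by_contra! hcon
  choose s hs μ hμ hbad using fun j : ℕ => hcon (j : ℝ)
  have hp : ∀ j, IsProbabilityMeasure (μ j) := fun j => hprob _ _ (hμ j)
  let ν : ℕ → ProbabilityMeasure (EuclideanSpace ℝ (Fin d)) := fun j => ⟨μ j, hp j⟩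
  let ν₀ : ProbabilityMeasure (EuclideanSpace ℝ (Fin d)) :=
    ⟨stdGaussian (EuclideanSpace ℝ (Fin d)), inferInstance⟩
  have hlim : Tendsto ν atTop (𝓝 ν₀) := by
    refine ProbabilityMeasure.tendsto_iff_tendsto_charFun.2 fun t => ?_
    rw [Metric.tendsto_atTop]
    intro ε hε
    obtain ⟨N, hN⟩ := h t (ε / 2) (half_pos hε)
    obtain ⟨j₀, hj₀⟩ := exists_nat_ge N
    refine ⟨j₀, fun j hj => ?_⟩
    rw [dist_eq_norm]
    have hle : (j₀ : ℝ) ≤ j := by exact_mod_cast hj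
    exact (hN (s j) (hj₀.trans (hle.trans (hs j))) _ (hμ j)).trans_lt (half_lt_self hε)
  have h2 := ProbabilityMeasure.tendsto_measure_of_null_frontier_of_tendsto' hlim
    (E := {y | ∀ k, y k ≤ x k}) (stdGaussian_frontier_orthant x)
  have h3 := (ENNReal.tendsto_toReal (measure_ne_top
    (ν₀ : Measure (EuclideanSpace ℝ (Fin d))) {y | ∀ k, y k ≤ x k})).comp h2
  obtain ⟨j, hj⟩ := (Metric.tendsto_atTop.1 h3) δ hδ
  have := hj j le_rfl
  rw [Real.dist_eq] at this
  exact absurd this (not_lt.2 (hbad j))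

end Levy

section Bernoulli

/-- The second-order Taylor bound for `exp (ix)`, valid for all real `x`: it follows from the power
series for `|x| ≤ 1`, and from the triangle inequality otherwise. -/
theorem norm_cexp_I_sub_le (x : ℝ) :
    ‖Complex.exp (x * Complex.I) - (1 + x * Complex.I - x ^ 2 / 2)‖ ≤ 5 * |x| ^ 3 := by
  have hn : ‖(x : ℂ) * Complex.I‖ = |x| := by simp
  rcases le_or_gt |x| 1 with h | h
  · have := Complex.exp_bound (x := x * Complex.I) (hn.le.trans h) (n := 3) (by norm_num)
    rw [hn] at this
    have e : ∑ m ∈ Finset.range 3, ((x : ℂ) * Complex.I) ^ m / (m.factorial : ℂ) =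
        1 + x * Complex.I - x ^ 2 / 2 := by
      simp [Finset.sum_range_succ, Nat.factorial, mul_pow]
      ring
    rw [e] at this
    refine this.trans ?_
    have : 0 ≤ |x| ^ 3 := by positivity
    norm_num [Nat.factorial]
    linarith
  · have h1 : ‖Complex.exp (x * Complex.I)‖ = 1 := Complex.norm_exp_ofReal_mul_I x
    have h2 : ‖(1 + x * Complex.I - x ^ 2 / 2 : ℂ)‖ ≤ 1 + |x| + |x| ^ 2 / 2 := by
      calc _ ≤ ‖(1 : ℂ)‖ + ‖(x : ℂ) * Complex.I‖ + ‖(x ^ 2 / 2 : ℂ)‖ :=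
            (norm_sub_le _ _).trans (by gcongr; exact norm_add_le _ _)
        _ = _ := by simp
    have h3 := norm_sub_le (Complex.exp (x * Complex.I)) (1 + x * Complex.I - x ^ 2 / 2)
    have h4 : |x| ≤ |x| ^ 3 := le_self_pow₀ h.le (by norm_num)
    have h5 : |x| ^ 2 ≤ |x| ^ 3 := pow_le_pow_right₀ h.le (by norm_num)
    linarith

theorem abs_exp_neg_sub_le {y : ℝ} (hy : 0 ≤ y) : |Real.exp (-y) - (1 - y)| ≤ y ^ 2 := by
  have h1 := Real.add_one_le_exp (-y)
  have h2 : Real.exp (-y) ≤ 1 - y + y ^ 2 := by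
    have h3 := Real.add_one_le_exp y
    rw [Real.exp_neg]
    refine (inv_anti₀ (by linarith) h3).trans ?_
    rw [inv_le_iff_one_le_mul₀ (by linarith)]
    nlinarith [pow_nonneg hy 3]
  rw [abs_le]
  constructor <;> nlinarith [sq_nonneg y]

/-- The characteristic function of a centred Bernoulli variable, compared with the Gaussian one. -/
theorem norm_bernoulli_charFun_sub_le (β : ℝ) {q : ℝ} (hq0 : 0 ≤ q) (hq1 : q ≤ 1) :
    ‖((q : ℂ) * Complex.exp (((β * (1 - q) : ℝ) : ℂ) * Complex.I) +
        (1 - q) * Complex.exp (((β * (0 - q) : ℝ) : ℂ) * Complex.I)) -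
      Complex.exp (((-(β ^ 2 * (q * (1 - q)) / 2) : ℝ) : ℂ))‖ ≤
      5 * (|β| ^ 3 * q) + |β| ^ 4 * q := by
  set u : ℝ := β * (1 - q) with hu
  set v : ℝ := β * (0 - q) with hv
  set y : ℝ := β ^ 2 * (q * (1 - q)) / 2 with hy
  have hy0 : 0 ≤ y := by have : 0 ≤ 1 - q := by linarith
                         positivity
  have e : ((q : ℂ) * Complex.exp ((u : ℂ) * Complex.I) +
        (1 - q) * Complex.exp ((v : ℂ) * Complex.I)) - Complex.exp (((-y : ℝ) : ℂ)) =
      (q : ℂ) * (Complex.exp ((u : ℂ) * Complex.I) - (1 + u * Complex.I - u ^ 2 / 2)) +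
        ((1 - q : ℝ) : ℂ) * (Complex.exp ((v : ℂ) * Complex.I) - (1 + v * Complex.I - v ^ 2 / 2)) -
        ((Real.exp (-y) - (1 - y) : ℝ) : ℂ) := by
    push_cast [hu, hv, hy]
    ring
  rw [e]
  have h1 := norm_cexp_I_sub_le u
  have h2 := norm_cexp_I_sub_le v
  have h3 := abs_exp_neg_sub_le hy0
  have hq : 0 ≤ 1 - q := by linarith
  have hu3 : |u| ^ 3 = |β| ^ 3 * (1 - q) ^ 3 := by
    rw [hu, abs_mul, abs_of_nonneg hq, mul_pow]
  have hv3 : |v| ^ 3 = |β| ^ 3 * q ^ 3 := by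
    rw [hv, abs_mul, zero_sub, abs_neg, abs_of_nonneg hq0, mul_pow]
  calc _ ≤ q * (5 * |u| ^ 3) + (1 - q) * (5 * |v| ^ 3) + y ^ 2 := by
        refine (norm_sub_le _ _).trans (add_le_add ((norm_add_le _ _).trans ?_) ?_)
        · rw [norm_mul, norm_mul, Complex.norm_real, Complex.norm_real, Real.norm_eq_abs,
            Real.norm_eq_abs, abs_of_nonneg hq0, abs_of_nonneg hq]
          gcongr
        · rwa [Complex.norm_real, Real.norm_eq_abs]
    _ ≤ _ := by
        rw [hu3, hv3]
        have hb3 : 0 ≤ |β| ^ 3 := by positivity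
        have hb4 : 0 ≤ |β| ^ 4 := by positivity
        have h5 : q * (1 - q) ^ 3 + (1 - q) * q ^ 3 ≤ q := by
          have := mul_nonneg hq0 hq
          nlinarith [mul_nonneg this hq, mul_nonneg this hq0]
        have h6 : y ^ 2 ≤ |β| ^ 4 * q := by
          have : y ^ 2 = |β| ^ 4 * ((q * (1 - q)) ^ 2 / 4) := by
            rw [hy, show |β| ^ 4 = β ^ 4 by rw [← abs_pow]; exact abs_of_nonneg (by positivity)]
            ring
          rw [this]
          refine mul_le_mul_of_nonneg_left ?_ hb4
          have h7 : q * (1 - q) ≤ q := by nlinarith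
          have := mul_nonneg hq0 hq
          nlinarith
        nlinarith [mul_le_mul_of_nonneg_left h5 hb3]

theorem norm_prod_sub_prod_le {ι : Type*} (t : Finset ι) (f g : ι → ℂ)
    (hf : ∀ i ∈ t, ‖f i‖ ≤ 1) (hg : ∀ i ∈ t, ‖g i‖ ≤ 1) :
    ‖∏ i ∈ t, f i - ∏ i ∈ t, g i‖ ≤ ∑ i ∈ t, ‖f i - g i‖ := by
  classical
  induction t using Finset.induction_on with
  | empty => simp
  | insert i t hi ih =>
    rw [Finset.prod_insert hi, Finset.prod_insert hi, Finset.sum_insert hi]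
    have h1 : ‖∏ j ∈ t, f j‖ ≤ 1 := by
      rw [norm_prod]
      exact Finset.prod_le_one (fun _ _ => norm_nonneg _)
        fun j hj => hf j (Finset.mem_insert_of_mem hj)
    have h2 := ih (fun j hj => hf j (Finset.mem_insert_of_mem hj))
      (fun j hj => hg j (Finset.mem_insert_of_mem hj))
    have h3 := hg i (Finset.mem_insert_self i t)
    have e : f i * ∏ j ∈ t, f j - g i * ∏ j ∈ t, g j =
        (f i - g i) * ∏ j ∈ t, f j + g i * (∏ j ∈ t, f j - ∏ j ∈ t, g j) := by ring
    rw [e]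
    refine (norm_add_le _ _).trans ?_
    rw [norm_mul, norm_mul]
    have := norm_nonneg (f i - g i)
    have := norm_nonneg (∏ j ∈ t, f j - ∏ j ∈ t, g j)
    nlinarith

end Bernoulli

/-! ### Moments and characteristic functions of independent selections -/

section Sampling

/-- The selection indicator: `1` if the uniform variable `v` is at most `q`, and `0` otherwise. -/
noncomputable def selInd (q v : ℝ) : ℝ := if v ≤ q then 1 else 0

instance isProbabilityMeasure_restrict_Ioo :
    IsProbabilityMeasure ((volume : Measure ℝ).restrict (Set.Ioo 0 1)) :=
  ⟨by simp⟩

instance isProbabilityMeasure_uniformLaw (n : ℕ) : IsProbabilityMeasure (uniformLaw n) := by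
  unfold uniformLaw; infer_instance

theorem integral_uniform_ite {F : Type*} [NormedAddCommGroup F] [NormedSpace ℝ F] [CompleteSpace F]
    {q : ℝ} (hq0 : 0 ≤ q) (hq1 : q ≤ 1) (a b : F) :
    ∫ v in Set.Ioo (0 : ℝ) 1, (if v ≤ q then a else b) = q • a + (1 - q) • b := by
  have e : (fun v : ℝ => if v ≤ q then a else b) =
      fun v => (Set.Iic q).indicator (fun _ => a - b) v + b := by
    ext v
    by_cases h : v ≤ q <;> simp [h]
  have hvol : ((volume : Measure ℝ).restrict (Set.Ioo 0 1)).real (Set.Iic q) = q := by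
    rw [measureReal_restrict_apply measurableSet_Iic]
    rcases hq1.eq_or_lt with rfl | h
    · have : (Set.Iic 1 ∩ Set.Ioo 0 1 : Set ℝ) = Set.Ioo 0 1 := by
        ext v; simp; intros; linarith
      rw [this]; simp
    · have : (Set.Iic q ∩ Set.Ioo 0 1 : Set ℝ) = Set.Ioc 0 q := by
        ext v
        simp only [Set.mem_inter_iff, Set.mem_Iic, Set.mem_Ioo, Set.mem_Ioc]
        exact ⟨fun h => ⟨h.2.1, h.1⟩, fun h' => ⟨h'.2, h'.1, h'.2.trans_lt h⟩⟩
      rw [this]; simp [hq0]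
  rw [e, integral_add, integral_indicator_const _ measurableSet_Iic, hvol]
  · simp
    module
  · exact (integrable_const _).indicator measurableSet_Iic
  · exact integrable_const _

theorem measurable_selInd (q : ℝ) : Measurable (selInd q) :=
  Measurable.ite measurableSet_Iic measurable_const measurable_const

theorem abs_selInd_le (q v : ℝ) : |selInd q v| ≤ 1 := by
  unfold selInd; split_ifs <;> simp

theorem selInd_nonneg (q v : ℝ) : 0 ≤ selInd q v := by
  unfold selInd; split_ifs <;> simp

theorem memLp_selInd (q : ℝ) :
    MemLp (selInd q) 2 ((volume : Measure ℝ).restrict (Set.Ioo 0 1)) :=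
  MemLp.of_bound (measurable_selInd q).aestronglyMeasurable 1
    (Eventually.of_forall (abs_selInd_le q))

variable {n : ℕ} {q : Fin n → ℝ}

/-- Lyapunov's bound for the characteristic function of a weighted sum of independent centred
selection indicators. -/
theorem norm_integral_cexp_sum_sub_le (hq0 : ∀ i, 0 ≤ q i) (hq1 : ∀ i, q i ≤ 1) (β : Fin n → ℝ) :
    ‖∫ u, Complex.exp (((∑ i, β i * (selInd (q i) (u i) - q i) : ℝ) : ℂ) * Complex.I)
        ∂(uniformLaw n) -
      Complex.exp (((-((∑ i, β i ^ 2 * (q i * (1 - q i))) / 2) : ℝ) : ℂ))‖ ≤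
      ∑ i, (5 * (|β i| ^ 3 * q i) + |β i| ^ 4 * q i) := by
  have e1 : ∀ u : Fin n → ℝ,
      Complex.exp (((∑ i, β i * (selInd (q i) (u i) - q i) : ℝ) : ℂ) * Complex.I) =
      ∏ i, Complex.exp (((β i * (selInd (q i) (u i) - q i) : ℝ) : ℂ) * Complex.I) := fun u => by
    rw [← Complex.exp_sum, Complex.ofReal_sum, Finset.sum_mul]
  have e2 : ∀ i, ∫ v in Set.Ioo (0 : ℝ) 1,
      Complex.exp (((β i * (selInd (q i) v - q i) : ℝ) : ℂ) * Complex.I) =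
      (q i : ℂ) * Complex.exp (((β i * (1 - q i) : ℝ) : ℂ) * Complex.I) +
        (1 - q i) * Complex.exp (((β i * (0 - q i) : ℝ) : ℂ) * Complex.I) := fun i => by
    have h := integral_uniform_ite (hq0 i) (hq1 i)
      (Complex.exp (((β i * (1 - q i) : ℝ) : ℂ) * Complex.I))
      (Complex.exp (((β i * (0 - q i) : ℝ) : ℂ) * Complex.I))
    rw [Complex.real_smul, Complex.real_smul, Complex.ofReal_sub, Complex.ofReal_one] at h
    rw [← h]
    congr 1
    ext v
    by_cases h : v ≤ q i <;> simp [selInd, h]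
  have e3 : Complex.exp (((-((∑ i, β i ^ 2 * (q i * (1 - q i))) / 2) : ℝ) : ℂ)) =
      ∏ i, Complex.exp (((-(β i ^ 2 * (q i * (1 - q i)) / 2) : ℝ) : ℂ)) := by
    rw [← Complex.exp_sum, ← Complex.ofReal_sum, Finset.sum_neg_distrib, Finset.sum_div]
  simp_rw [e1]
  rw [e3, uniformLaw, integral_fintype_prod_eq_prod (fun i v =>
    Complex.exp (((β i * (selInd (q i) v - q i) : ℝ) : ℂ) * Complex.I))]
  simp_rw [e2]
  refine (norm_prod_sub_prod_le _ _ _ (fun i _ => ?_) (fun i _ => ?_)).trans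
    (Finset.sum_le_sum fun i _ => norm_bernoulli_charFun_sub_le (β i) (hq0 i) (hq1 i))
  · rw [← e2]
    refine (norm_integral_le_of_norm_le_const (C := 1) (Eventually.of_forall fun v => ?_)).trans ?_
    · rw [Complex.norm_exp_ofReal_mul_I]
    · simp
  · rw [Complex.norm_exp_ofReal]
    refine Real.exp_le_one_iff.2 ?_
    have := mul_nonneg (hq0 i) (sub_nonneg.2 (hq1 i))
    have : 0 ≤ β i ^ 2 * (q i * (1 - q i)) := by positivity
    linarith

theorem integral_selInd {r : ℝ} (h0 : 0 ≤ r) (h1 : r ≤ 1) :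
    ∫ v in Set.Ioo (0 : ℝ) 1, selInd r v = r := by
  simpa [selInd] using integral_uniform_ite h0 h1 (1 : ℝ) 0

theorem variance_selInd_le {r : ℝ} (h0 : 0 ≤ r) (h1 : r ≤ 1) :
    Var[selInd r; (volume : Measure ℝ).restrict (Set.Ioo 0 1)] ≤ r := by
  refine (variance_le_expectation_sq (measurable_selInd r).aestronglyMeasurable).trans ?_
  have : selInd r ^ 2 = selInd r := by
    ext v; by_cases h : v ≤ r <;> simp [selInd, h]
  rw [this, integral_selInd h0 h1]

theorem integrable_selInd_eval (r : ℝ) (i : Fin n) :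
    Integrable (fun u => selInd r (u i)) (uniformLaw n) :=
  Integrable.of_bound ((measurable_selInd _).comp (measurable_pi_apply i)).aestronglyMeasurable
    1 (Eventually.of_forall fun _ => abs_selInd_le _ _)

theorem integrable_sum_selInd (a q : Fin n → ℝ) :
    Integrable (fun u => ∑ i, a i * selInd (q i) (u i)) (uniformLaw n) :=
  integrable_finsetSum _ fun i _ => (integrable_selInd_eval _ i).const_mul _

theorem integral_sum_selInd (hq0 : ∀ i, 0 ≤ q i) (hq1 : ∀ i, q i ≤ 1) (a : Fin n → ℝ) :
    ∫ u, ∑ i, a i * selInd (q i) (u i) ∂(uniformLaw n) = ∑ i, a i * q i := by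
  rw [integral_finsetSum]
  · refine Finset.sum_congr rfl fun i _ => ?_
    rw [integral_const_mul, uniformLaw, integral_comp_eval
      (μ := fun _ : Fin n => (volume : Measure ℝ).restrict (Set.Ioo 0 1)) (i := i)
      (f := selInd (q i)) (measurable_selInd _).aestronglyMeasurable, integral_selInd (hq0 i) (hq1 i)]
  · intro i _
    exact (integrable_selInd_eval _ i).const_mul _

theorem uniformLaw_abs_sum_ge_le (hq0 : ∀ i, 0 ≤ q i) (hq1 : ∀ i, q i ≤ 1) (a : Fin n → ℝ)
    {ε : ℝ} (hε : 0 < ε) :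
    (uniformLaw n).real {u | ε ≤ |∑ i, a i * selInd (q i) (u i) - ∑ i, a i * q i|} ≤
      (∑ i, a i ^ 2 * q i) / ε ^ 2 := by
  have hL : ∀ i, MemLp (fun v => a i * selInd (q i) v) 2
      ((volume : Measure ℝ).restrict (Set.Ioo 0 1)) := fun i => (memLp_selInd _).const_mul _
  have hsum : (∑ i, fun u : Fin n → ℝ => a i * selInd (q i) (u i)) =
      fun u => ∑ i, a i * selInd (q i) (u i) := by ext u; simp
  have hvar := variance_sum_pi hL
  have hmem : MemLp (fun u : Fin n → ℝ => ∑ i, a i * selInd (q i) (u i)) 2 (uniformLaw n) := by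
    refine memLp_finsetSum _ fun i _ => ?_
    exact (hL i).comp_measurePreserving (measurePreserving_eval _ i)
  have := meas_ge_le_variance_div_sq hmem hε
  rw [integral_sum_selInd hq0 hq1] at this
  rw [measureReal_def]
  refine (ENNReal.toReal_mono ENNReal.ofReal_ne_top this).trans ?_
  rw [ENNReal.toReal_ofReal (div_nonneg (variance_nonneg _ _) (sq_nonneg _))]
  gcongr
  rw [hsum] at hvar
  rw [uniformLaw, hvar]
  refine Finset.sum_le_sum fun i _ => ?_
  rw [variance_const_mul]
  gcongr
  exact variance_selInd_le (hq0 i) (hq1 i)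

theorem uniformLaw_sum_ge_le (hq0 : ∀ i, 0 ≤ q i) (hq1 : ∀ i, q i ≤ 1) {a : Fin n → ℝ}
    (ha : ∀ i, 0 ≤ a i) {M : ℝ} (hM : 0 < M) :
    (uniformLaw n).real {u | M ≤ ∑ i, a i * selInd (q i) (u i)} ≤ (∑ i, a i * q i) / M := by
  have := mul_meas_ge_le_integral_of_nonneg (Eventually.of_forall fun u : Fin n → ℝ =>
    (Finset.sum_nonneg fun i _ => mul_nonneg (ha i) (selInd_nonneg (q i) (u i))))
    (integrable_sum_selInd a q) M
  rw [integral_sum_selInd hq0 hq1] at this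
  rw [le_div_iff₀ hM]
  linarith

end Sampling

/-! ### The variance matrices and their standardization -/

section Matrices

variable {d : ℕ}

theorem Matrix.PosDef.spectrum_pos {A : Matrix (Fin d) (Fin d) ℝ} (hA : A.PosDef) {x : ℝ}
    (hx : x ∈ spectrum ℝ A) : 0 < x := by
  rw [hA.1.spectrum_real_eq_range_eigenvalues] at hx
  obtain ⟨i, rfl⟩ := hx
  exact hA.eigenvalues_pos i

theorem continuousOn_inv_sqrt_spectrum {A : Matrix (Fin d) (Fin d) ℝ} (hA : A.PosDef) :
    ContinuousOn (fun x : ℝ => (Real.sqrt x)⁻¹) (spectrum ℝ A) :=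
  Real.continuous_sqrt.continuousOn.inv₀ fun _ hx => (Real.sqrt_pos.2 (hA.spectrum_pos hx)).ne'

theorem invSqrt_isHermitian (A : Matrix (Fin d) (Fin d) ℝ) : (invSqrt A).IsHermitian :=
  cfc_predicate (R := ℝ) (p := IsSelfAdjoint) _ A

theorem invSqrt_mul_mul_invSqrt {A : Matrix (Fin d) (Fin d) ℝ} (hA : A.PosDef) :
    invSqrt A * A * invSqrt A = 1 := by
  have hsa : IsSelfAdjoint A := hA.1
  have hc := continuousOn_inv_sqrt_spectrum hA
  have h1 : invSqrt A * A * invSqrt A =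
      cfc (fun x : ℝ => (Real.sqrt x)⁻¹ * x * (Real.sqrt x)⁻¹) A := by
    rw [cfc_mul (fun x : ℝ => (Real.sqrt x)⁻¹ * x) _ A (hc.mul (continuousOn_id' _)) hc,
      cfc_mul _ (fun x : ℝ => x) A hc (continuousOn_id' _),
      cfc_id' ℝ A]
    rfl
  rw [h1, ← cfc_one ℝ A]
  refine cfc_congr fun x hx => ?_
  have h := hA.spectrum_pos hx
  have h2 := Real.sq_sqrt h.le
  have h3 := (Real.sqrt_pos.2 h).ne'
  simp only [Pi.one_apply]
  field_simp
  linarith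

theorem isUnit_of_quadForm_neg {H : Matrix (Fin d) (Fin d) ℝ} {lam : ℝ} (hlam : 0 < lam)
    (hH : ∀ v : EuclideanSpace ℝ (Fin d), ∑ k, (∑ l, H k l * v l) * v k ≤ -(lam * ‖v‖ ^ 2)) :
    IsUnit H := by
  rw [← Matrix.mulVec_injective_iff_isUnit]
  intro v w hvw
  have h0 : H.mulVec (v - w) = 0 := by rw [Matrix.mulVec_sub, hvw, sub_self]
  have h1 := hH (WithLp.toLp 2 (v - w))
  have h2 : ∀ k, ∑ l, H k l * (v - w) l = 0 := fun k => congrFun h0 k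
  simp only [h2] at h1
  have h3 : ‖WithLp.toLp 2 (v - w)‖ = 0 := by
    simp only [zero_mul, Finset.sum_const_zero] at h1
    have : ‖WithLp.toLp 2 (v - w)‖ ^ 2 ≤ 0 := by nlinarith
    exact pow_eq_zero_iff (two_ne_zero) |>.1 (le_antisymm this (sq_nonneg _))
  rw [norm_eq_zero] at h3
  exact sub_eq_zero.1 ((WithLp.toLp_eq_zero 2).1 h3)

/-- The sandwich `H⁻¹ Λ H⁻¹` with a symmetric invertible `H`. -/
theorem posDef_inv_mul_mul_inv {H Λ : Matrix (Fin d) (Fin d) ℝ} (hH : H.IsHermitian)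
    (hu : IsUnit H) (hΛ : Λ.PosDef) : (H⁻¹ * Λ * H⁻¹).PosDef := by
  have h := hΛ.conjTranspose_mul_mul_same (B := H⁻¹)
    (Matrix.mulVec_injective_iff_isUnit.2 ((Matrix.isUnit_nonsing_inv_iff).2 hu))
  rwa [hH.inv.eq] at h

theorem posSemidef_inv_mul_mul_inv {H Λ : Matrix (Fin d) (Fin d) ℝ} (hH : H.IsHermitian)
    (hΛ : Λ.PosSemidef) : (H⁻¹ * Λ * H⁻¹).PosSemidef := by
  have h := hΛ.conjTranspose_mul_mul_same H⁻¹
  rwa [hH.inv.eq] at h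

theorem posDef_of_sub_smul_one {Λ : Matrix (Fin d) (Fin d) ℝ} {c : ℝ} (hc : 0 < c)
    (h : (Λ - c • (1 : Matrix (Fin d) (Fin d) ℝ)).PosSemidef) : Λ.PosDef := by
  have := (Matrix.PosDef.one (n := Fin d) (R := ℝ)).smul hc
  simpa using Matrix.PosDef.posSemidef_add h this

/-- The standardizing matrix `B = V^{-1/2} H⁻¹`, for `V = H⁻¹ Λ H⁻¹`, satisfies `B Λ Bᵀ = 1`. -/
theorem standardize_mul_mul_transpose {H Λ : Matrix (Fin d) (Fin d) ℝ} (hH : H.IsHermitian)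
    (hu : IsUnit H) (hΛ : Λ.PosDef) :
    (invSqrt (H⁻¹ * Λ * H⁻¹) * H⁻¹) * Λ * (invSqrt (H⁻¹ * Λ * H⁻¹) * H⁻¹).transpose = 1 := by
  have h1 := invSqrt_mul_mul_invSqrt (posDef_inv_mul_mul_inv hH hu hΛ)
  have h2 : (invSqrt (H⁻¹ * Λ * H⁻¹)).transpose = invSqrt (H⁻¹ * Λ * H⁻¹) := by
    simpa [Matrix.IsHermitian, Matrix.conjTranspose_eq_transpose_of_trivial] using
      invSqrt_isHermitian (H⁻¹ * Λ * H⁻¹)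
  have h3 : (H⁻¹).transpose = H⁻¹ := by
    simpa [Matrix.IsHermitian, Matrix.conjTranspose_eq_transpose_of_trivial] using hH.inv
  rw [Matrix.transpose_mul, h2, h3]
  calc _ = invSqrt (H⁻¹ * Λ * H⁻¹) * (H⁻¹ * Λ * H⁻¹) * invSqrt (H⁻¹ * Λ * H⁻¹) := by
        simp only [Matrix.mul_assoc]
    _ = 1 := h1

theorem norm_toLp_sq (t : Fin d → ℝ) : ‖WithLp.toLp 2 t‖ ^ 2 = t ⬝ᵥ t := by
  rw [EuclideanSpace.norm_sq_eq]
  simp [dotProduct, sq]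

/-- If `B Λ Bᵀ = 1` then the quadratic form of `Λ` at `Bᵀ t` is `|t|²`. -/
theorem quadForm_vecMul {B Λ : Matrix (Fin d) (Fin d) ℝ} (hB : B * Λ * B.transpose = 1)
    (t : Fin d → ℝ) : (Matrix.vecMul t B) ⬝ᵥ (Λ.mulVec (Matrix.vecMul t B)) = t ⬝ᵥ t := by
  rw [← Matrix.mulVec_transpose B t, Matrix.mulVec_mulVec, Matrix.mulVec_transpose,
    ← Matrix.dotProduct_mulVec, Matrix.mulVec_mulVec, ← Matrix.mul_assoc, hB, Matrix.one_mulVec]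

theorem norm_vecMul_le {B Λ : Matrix (Fin d) (Fin d) ℝ} (hB : B * Λ * B.transpose = 1) {c : ℝ}
    (hc : 0 < c) (hΛ : (Λ - c • (1 : Matrix (Fin d) (Fin d) ℝ)).PosSemidef) (t : Fin d → ℝ) :
    ‖WithLp.toLp 2 (Matrix.vecMul t B)‖ ≤ ‖WithLp.toLp 2 t‖ / Real.sqrt c := by
  rw [le_div_iff₀ (Real.sqrt_pos.2 hc)]
  refine abs_le_of_sq_le_sq' ?_ (norm_nonneg _) |>.2
  rw [mul_pow, Real.sq_sqrt hc.le, norm_toLp_sq, norm_toLp_sq, ← quadForm_vecMul hB t]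
  have h := hΛ.dotProduct_mulVec_nonneg (Matrix.vecMul t B)
  rw [Matrix.sub_mulVec, dotProduct_sub, Matrix.smul_mulVec, Matrix.one_mulVec,
    dotProduct_smul, star_trivial, smul_eq_mul] at h
  linarith

theorem abs_dotProduct_mulVec_le {B Λ : Matrix (Fin d) (Fin d) ℝ} (hB : B * Λ * B.transpose = 1)
    {c : ℝ} (hc : 0 < c) (hΛ : (Λ - c • (1 : Matrix (Fin d) (Fin d) ℝ)).PosSemidef)
    (t v : Fin d → ℝ) :
    |t ⬝ᵥ B.mulVec v| ≤ ‖WithLp.toLp 2 t‖ / Real.sqrt c * ‖WithLp.toLp 2 v‖ := by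
  rw [Matrix.dotProduct_mulVec]
  have h1 : Matrix.vecMul t B ⬝ᵥ v =
      inner ℝ (WithLp.toLp 2 v) (WithLp.toLp 2 (Matrix.vecMul t B)) := by
    rw [EuclideanSpace.inner_toLp_toLp]; simp
  rw [h1]
  refine (abs_real_inner_le_norm _ _).trans ?_
  rw [mul_comm]
  gcongr
  exact norm_vecMul_le hB hc hΛ t

theorem posSemidef_sum_vecMulVec {n : ℕ} (g : Fin n → Fin d → ℝ) {w : Fin n → ℝ}
    (hw : ∀ i, 0 ≤ w i) : (∑ i, w i • Matrix.vecMulVec (g i) (g i)).PosSemidef :=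
  Matrix.posSemidef_sum _ fun i _ => by
    simpa using (Matrix.posSemidef_vecMulVec_self_star (g i)).smul (hw i)

theorem quadForm_sum_vecMulVec {n : ℕ} (g : Fin n → Fin d → ℝ) (w : Fin n → ℝ) (v : Fin d → ℝ) :
    v ⬝ᵥ (∑ i, w i • Matrix.vecMulVec (g i) (g i)).mulVec v = ∑ i, w i * (v ⬝ᵥ g i) ^ 2 := by
  rw [Matrix.sum_mulVec, dotProduct_sum]
  refine Finset.sum_congr rfl fun i _ => ?_
  rw [Matrix.smul_mulVec, Matrix.vecMulVec_mulVec]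
  simp [dotProduct_comm v (g i), sq]

end Matrices

section Variances

variable {𝒵 : Type*} {d n : ℕ} (m : 𝒵 → EuclideanSpace ℝ (Fin d) → ℝ)

theorem lamP_eq (s : ℝ) (z : Fin n → 𝒵) (p : Fin n → ℝ) (θ : EuclideanSpace ℝ (Fin d)) :
    lamP m s z p θ = ∑ i, (((n : ℝ) ^ 2)⁻¹ * ((p i)⁻¹ - s)) •
      Matrix.vecMulVec (grad (m (z i)) θ) (grad (m (z i)) θ) := by
  rw [lamP, lamR, Finset.smul_sum, Finset.smul_sum, ← Finset.sum_sub_distrib]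
  refine Finset.sum_congr rfl fun i _ => ?_
  rw [smul_smul, ← sub_smul]
  congr 1
  ring

theorem lamR_sub_lamP (s : ℝ) (z : Fin n → 𝒵) (p : Fin n → ℝ) (θ : EuclideanSpace ℝ (Fin d)) :
    lamR m z p θ - lamP m s z p θ = ∑ i, (s / (n : ℝ) ^ 2) •
      Matrix.vecMulVec (grad (m (z i)) θ) (grad (m (z i)) θ) := by
  rw [lamP, sub_sub_cancel, Finset.smul_sum]

theorem lamR_sub_lamP_posSemidef {s : ℝ} (hs : 0 ≤ s) (z : Fin n → 𝒵) (p : Fin n → ℝ)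
    (θ : EuclideanSpace ℝ (Fin d)) : (lamR m z p θ - lamP m s z p θ).PosSemidef := by
  rw [lamR_sub_lamP]
  exact posSemidef_sum_vecMulVec _ fun _ => by positivity

/-- The difference of the two variance matrices inherits its definiteness from `Λ_{n,P}`: a vector
in the kernel of `∑ᵢ ṁ ṁᵀ` is orthogonal to all gradients, hence in the kernel of `Λ_{n,P}`. -/
theorem lamR_sub_lamP_posDef {s : ℝ} (hs : 0 < s) {z : Fin n → 𝒵} {p : Fin n → ℝ} (hn : 1 ≤ n)
    {θ : EuclideanSpace ℝ (Fin d)} (h : (lamP m s z p θ).PosDef) :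
    (lamR m z p θ - lamP m s z p θ).PosDef := by
  have hps := lamR_sub_lamP_posSemidef m hs.le z p θ
  refine Matrix.PosDef.of_dotProduct_mulVec_pos hps.1 fun v hv => ?_
  refine lt_of_le_of_ne (hps.dotProduct_mulVec_nonneg v) fun h0 => ?_
  have h1 := h.dotProduct_mulVec_pos hv
  rw [star_trivial, lamR_sub_lamP, quadForm_sum_vecMulVec] at h0
  rw [star_trivial, lamP_eq, quadForm_sum_vecMulVec] at h1
  have hn' : (0 : ℝ) < n := by exact_mod_cast hn
  have h2 := (Finset.sum_eq_zero_iff_of_nonneg fun i _ => by positivity).1 h0.symm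
  refine h1.ne' (Finset.sum_eq_zero fun i hi => ?_)
  have h3 := h2 i hi
  have : (s / (n : ℝ) ^ 2) ≠ 0 := by positivity
  rw [(mul_eq_zero.1 h3).resolve_left this, mul_zero]

theorem hessN_apply (z : Fin n → 𝒵) (θ : EuclideanSpace ℝ (Fin d)) (k l : Fin d) :
    hessN m z θ k l = (n : ℝ)⁻¹ * ∑ i, hess (m (z i)) θ k l := by
  simp [hessN, Matrix.sum_apply]

theorem hessN_isHermitian {z : Fin n → 𝒵} {θ : EuclideanSpace ℝ (Fin d)}
    (h : ∀ i, ContDiffAt ℝ 2 (m (z i)) θ) : (hessN m z θ).IsHermitian := by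
  ext k l
  rw [Matrix.conjTranspose_apply, hessN_apply, hessN_apply, star_trivial]
  congr 1
  exact Finset.sum_congr rfl fun i _ => (h i).hess_isHermitian.apply k l

theorem varR_sub_varP (s : ℝ) (z : Fin n → 𝒵) (p : Fin n → ℝ) (θ : EuclideanSpace ℝ (Fin d)) :
    varR m z p θ - varP m s z p θ =
      (hessN m z θ)⁻¹ * (lamR m z p θ - lamP m s z p θ) * (hessN m z θ)⁻¹ := by
  rw [varR, varP, Matrix.mul_sub, Matrix.sub_mul]

end Variances

/-! ### Weighted objectives and inverse-probability weights -/

section WeightedObjective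

variable {𝒵 : Type*} {d n : ℕ} {m : 𝒵 → EuclideanSpace ℝ (Fin d) → ℝ}
  {Θ : Set (EuclideanSpace ℝ (Fin d))}

/-- The weighted objective `∑ᵢ wᵢ m(zᵢ, θ)`, of which the full-data objective and the subsample
objective are special cases. -/
noncomputable def weightedObj (m : 𝒵 → EuclideanSpace ℝ (Fin d) → ℝ) (z : Fin n → 𝒵)
    (w : Fin n → ℝ) (θ : EuclideanSpace ℝ (Fin d)) : ℝ :=
  ∑ i, w i * m (z i) θ

theorem weightedObj_concaveOn (hm_conc : ∀ z, ConcaveOn ℝ (convexHull ℝ Θ) (m z))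
    (z : Fin n → 𝒵) {w : Fin n → ℝ} (hw : ∀ i, 0 ≤ w i) :
    ConcaveOn ℝ (convexHull ℝ Θ) (weightedObj m z w) := by
  refine ⟨convex_convexHull ℝ Θ, fun x hx y hy a b ha hb hab => ?_⟩
  simp only [weightedObj, smul_eq_mul, Finset.mul_sum, ← Finset.sum_add_distrib]
  refine Finset.sum_le_sum fun i _ => ?_
  have := (hm_conc (z i)).2 hx hy ha hb hab
  simp only [smul_eq_mul] at this
  calc _ = w i * (a * m (z i) x + b * m (z i) y) := by ring
    _ ≤ _ := mul_le_mul_of_nonneg_left this (hw i)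

theorem weightedObj_contDiffAt {z : Fin n → 𝒵} {a : EuclideanSpace ℝ (Fin d)}
    (h : ∀ i, ContDiffAt ℝ 2 (m (z i)) a) (w : Fin n → ℝ) :
    ContDiffAt ℝ 2 (weightedObj m z w) a := by
  unfold weightedObj
  exact ContDiffAt.sum fun i _ => contDiffAt_const.mul (h i)

theorem grad_weightedObj {z : Fin n → 𝒵} {a : EuclideanSpace ℝ (Fin d)}
    (h : ∀ i, ContDiffAt ℝ 2 (m (z i)) a) (w : Fin n → ℝ) (k : Fin d) :
    grad (weightedObj m z w) a k = ∑ i, w i * grad (m (z i)) a k :=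
  grad_sum _ w (fun i => m (z i)) (fun i _ => (h i).differentiableAt (by norm_num)) k

theorem hess_weightedObj {z : Fin n → 𝒵} {a : EuclideanSpace ℝ (Fin d)}
    (h : ∀ i, ContDiffAt ℝ 2 (m (z i)) a) (w : Fin n → ℝ) (k l : Fin d) :
    hess (weightedObj m z w) a k l = ∑ i, w i * hess (m (z i)) a k l :=
  hess_sum _ w (fun i => m (z i)) (fun i _ => h i) k l

theorem abs_hess_weightedObj_sub_le {ψ : 𝒵 → ℝ}
    (hm_smooth : ∀ z, ∀ θ ∈ Θ, ContDiffAt ℝ 2 (m z) θ)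
    (hH_lip : ∀ z, ∀ θ₁ ∈ Θ, ∀ θ₂ ∈ Θ, ∀ k l,
      |hess (m z) θ₁ k l - hess (m z) θ₂ k l| ≤ ψ z * ‖θ₁ - θ₂‖)
    (z : Fin n → 𝒵) {w : Fin n → ℝ} (hw : ∀ i, 0 ≤ w i) {η a : EuclideanSpace ℝ (Fin d)}
    (hη : η ∈ Θ) (ha : a ∈ Θ) (k l : Fin d) :
    |hess (weightedObj m z w) η k l - hess (weightedObj m z w) a k l| ≤
      (∑ i, w i * |ψ (z i)|) * ‖η - a‖ := by
  rw [hess_weightedObj (fun i => hm_smooth _ _ hη), hess_weightedObj (fun i => hm_smooth _ _ ha),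
    ← Finset.sum_sub_distrib, Finset.sum_mul]
  refine (Finset.abs_sum_le_sum_abs _ _).trans (Finset.sum_le_sum fun i _ => ?_)
  rw [← mul_sub, abs_mul, abs_of_nonneg (hw i), mul_assoc]
  refine mul_le_mul_of_nonneg_left ?_ (hw i)
  exact (hH_lip _ _ hη _ ha k l).trans (by gcongr; exact le_abs_self _)

theorem fullObj_eq (z : Fin n → 𝒵) : fullObj m z = weightedObj m z fun _ => (n : ℝ)⁻¹ := by
  ext θ
  rw [fullObj, weightedObj, Finset.mul_sum]

theorem hess_fullObj {z : Fin n → 𝒵} {a : EuclideanSpace ℝ (Fin d)}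
    (h : ∀ i, ContDiffAt ℝ 2 (m (z i)) a) (k l : Fin d) :
    hess (fullObj m z) a k l = hessN m z a k l := by
  rw [fullObj_eq, hess_weightedObj h, hessN_apply, Finset.mul_sum]

theorem grad_fullObj {z : Fin n → 𝒵} {a : EuclideanSpace ℝ (Fin d)}
    (h : ∀ i, ContDiffAt ℝ 2 (m (z i)) a) (k : Fin d) :
    grad (fullObj m z) a k = (n : ℝ)⁻¹ * ∑ i, grad (m (z i)) a k := by
  rw [fullObj_eq, grad_weightedObj h, Finset.mul_sum]

/-- A perturbation bound for the curvature condition. -/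
theorem quadForm_le_of_abs_sub_le {H H' : Matrix (Fin d) (Fin d) ℝ} {lam η : ℝ}
    (hH : ∀ v : EuclideanSpace ℝ (Fin d), ∑ k, (∑ l, H k l * v l) * v k ≤ -(lam * ‖v‖ ^ 2))
    (hd : ∀ k l, |H' k l - H k l| ≤ η) (v : EuclideanSpace ℝ (Fin d)) :
    ∑ k, (∑ l, H' k l * v l) * v k ≤ -((lam - d ^ 2 * η) * ‖v‖ ^ 2) := by
  have e : ∑ k, (∑ l, H' k l * v l) * v k = ∑ k, (∑ l, H k l * v l) * v k +
      ∑ k, (∑ l, (H' k l - H k l) * v l) * v k := by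
    rw [← Finset.sum_add_distrib]
    refine Finset.sum_congr rfl fun k _ => ?_
    rw [← add_mul, ← Finset.sum_add_distrib]
    congr 1
    exact Finset.sum_congr rfl fun l _ => by ring
  have h1 := (le_abs_self _).trans (abs_sum_mul_le (fun k => abs_sum_mul_le (hd k) v) v)
  rw [e]
  linarith [hH v]

end WeightedObjective

section SampledSums

variable {n : ℕ} {s K : ℝ} {p : Fin n → ℝ}

/-- The weight `1 / (n s πᵢ)` of a selected observation, and zero for the others. -/
noncomputable def sampWeight (s : ℝ) (p u : Fin n → ℝ) (i : Fin n) : ℝ :=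
  ((n : ℝ) * p i)⁻¹ / s * selInd (s * p i) (u i)

theorem sampWeight_nonneg (hs : 0 < s) (hp : ∀ i, 0 < p i) (u : Fin n → ℝ) (i : Fin n) :
    0 ≤ sampWeight s p u i := by
  have := hp i
  have := selInd_nonneg (s * p i) (u i)
  unfold sampWeight
  positivity

theorem sum_sampWeight_mul (s : ℝ) (p u a : Fin n → ℝ) :
    ∑ i, sampWeight s p u i * a i =
      ∑ i, (((n : ℝ) * p i)⁻¹ / s * a i) * selInd (s * p i) (u i) :=
  Finset.sum_congr rfl fun i _ => by rw [sampWeight]; ring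

theorem sum_weight_mul_prob (hs : 0 < s) (hp : ∀ i, 0 < p i) (a : Fin n → ℝ) :
    ∑ i, (((n : ℝ) * p i)⁻¹ / s * a i) * (s * p i) = (n : ℝ)⁻¹ * ∑ i, a i := by
  rw [Finset.mul_sum]
  refine Finset.sum_congr rfl fun i _ => ?_
  have := (hp i).ne'
  have := hs.ne'
  rw [mul_inv]
  field_simp

/-- Chebyshev's inequality for an inverse-probability weighted sum. -/
theorem uniformLaw_sampWeight_ge_le (hs : 0 < s) (hp : ∀ i, 0 < p i)
    (hp1 : ∀ i, s * p i ≤ 1) (hK : ∀ i, ((n : ℝ) * p i)⁻¹ ≤ K) (a : Fin n → ℝ) {M : ℝ}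
    (hM : 0 < M) :
    (uniformLaw n).real {u | M / Real.sqrt s ≤
      |∑ i, sampWeight s p u i * a i - (n : ℝ)⁻¹ * ∑ i, a i|} ≤
        K * ((n : ℝ)⁻¹ * ∑ i, a i ^ 2) / M ^ 2 := by
  have h := uniformLaw_abs_sum_ge_le (fun i => (mul_pos hs (hp i)).le) hp1
    (fun i => ((n : ℝ) * p i)⁻¹ / s * a i) (ε := M / Real.sqrt s) (by positivity)
  simp_rw [sum_sampWeight_mul]
  rw [sum_weight_mul_prob hs hp] at h
  refine h.trans ?_
  rw [div_pow, Real.sq_sqrt hs.le, div_div_eq_mul_div]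
  refine div_le_div_of_nonneg_right ?_ (sq_nonneg _)
  rw [Finset.sum_mul, ← mul_assoc, Finset.mul_sum]
  refine Finset.sum_le_sum fun i _ => ?_
  have h1 := (hp i).ne'
  have h2 := hs.ne'
  have e : (((n : ℝ) * p i)⁻¹ / s * a i) ^ 2 * (s * p i) * s =
      ((n : ℝ) * p i)⁻¹ * (n : ℝ)⁻¹ * a i ^ 2 := by
    rw [mul_inv]
    field_simp
  rw [e]
  have := hK i
  gcongr

theorem uniformLaw_sampWeight_markov (hs : 0 < s) (hp : ∀ i, 0 < p i)
    (hp1 : ∀ i, s * p i ≤ 1) {a : Fin n → ℝ} (ha : ∀ i, 0 ≤ a i) {M : ℝ} (hM : 0 < M) :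
    (uniformLaw n).real {u | M ≤ ∑ i, sampWeight s p u i * a i} ≤
      ((n : ℝ)⁻¹ * ∑ i, a i) / M := by
  have h := uniformLaw_sum_ge_le (fun i => (mul_pos hs (hp i)).le) hp1
    (a := fun i => ((n : ℝ) * p i)⁻¹ / s * a i)
    (fun i => by have := hp i; have := ha i; positivity) hM
  simp_rw [sum_sampWeight_mul]
  rwa [sum_weight_mul_prob hs hp] at h

theorem measurable_comp_poissonSelect {F : Type*} [MeasurableSpace F] (s : ℝ) (p : Fin n → ℝ)
    (g : Finset (Fin n) → F) : Measurable fun u => g (poissonSelect s p u) := by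
  classical
  have h1 : Measurable fun (u : Fin n → ℝ) (i : Fin n) => decide (u i ≤ s * p i) := by
    refine measurable_pi_lambda _ fun i => ?_
    refine measurable_to_bool ?_
    have : (fun u : Fin n → ℝ => decide (u i ≤ s * p i)) ⁻¹' {true} =
        {u | u i ≤ s * p i} := by ext u; simp
    rw [this]
    exact measurableSet_le (measurable_pi_apply i) measurable_const
  have h2 : Measurable fun b : Fin n → Bool => g (Finset.univ.filter fun i => b i = true) :=
    measurable_of_finite _
  convert h2.comp h1 using 2 with u
  simp only [poissonSelect, Function.comp_apply, decide_eq_true_eq]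

variable {𝒵 : Type*} {d : ℕ} {m : 𝒵 → EuclideanSpace ℝ (Fin d) → ℝ}

/-- The subsample objective, multiplied by `|S| / s`, is a weighted objective. For an empty
subsample both sides vanish. -/
theorem weightedObj_sampWeight (s : ℝ) (z : Fin n → 𝒵) (p u : Fin n → ℝ)
    (θ : EuclideanSpace ℝ (Fin d)) :
    weightedObj m z (sampWeight s p u) θ =
      ((poissonSelect s p u).card : ℝ) / s * subObj m z p (poissonSelect s p u) θ := by
  classical
  have h1 : weightedObj m z (sampWeight s p u) θ =
      ∑ i ∈ poissonSelect s p u, ((n : ℝ) * p i)⁻¹ / s * m (z i) θ := by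
    rw [weightedObj, poissonSelect, Finset.sum_filter]
    refine Finset.sum_congr rfl fun i _ => ?_
    by_cases h : u i ≤ s * p i <;> simp [sampWeight, selInd, h]
  rw [h1, subObj, Finset.mul_sum]
  refine Finset.sum_congr rfl fun i hi => ?_
  have : ((poissonSelect s p u).card : ℝ) ≠ 0 := by
    exact_mod_cast (Finset.card_pos.2 ⟨i, hi⟩).ne'
  field_simp

theorem isMaxOn_weightedObj {Θ : Set (EuclideanSpace ℝ (Fin d))} (hs : 0 < s) {z : Fin n → 𝒵}
    {u : Fin n → ℝ} {b : EuclideanSpace ℝ (Fin d)}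
    (h : IsMaxOn (subObj m z p (poissonSelect s p u)) Θ b) :
    IsMaxOn (weightedObj m z (sampWeight s p u)) Θ b := by
  intro θ hθ
  have := h hθ
  simp only [Set.mem_ofPred_eq, weightedObj_sampWeight] at this ⊢
  gcongr

end SampledSums

/-! ### The linearized estimation error -/

section CharFunComparison

theorem norm_cexp_sub_cexp_le (x y : ℝ) :
    ‖Complex.exp (x * Complex.I) - Complex.exp (y * Complex.I)‖ ≤ |x - y| := by
  have e : Complex.exp (x * Complex.I) - Complex.exp (y * Complex.I) =
      Complex.exp (y * Complex.I) * (Complex.exp (Complex.I * ((x - y : ℝ) : ℂ)) - 1) := by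
    rw [mul_sub, ← Complex.exp_add, mul_one]
    congr 2
    push_cast
    ring
  rw [e, norm_mul, Complex.norm_exp_ofReal_mul_I, one_mul]
  exact Real.norm_exp_I_mul_ofReal_sub_one_le

theorem norm_integral_cexp_sub_le {α : Type*} [MeasurableSpace α] {μ : Measure α}
    [IsProbabilityMeasure μ] {X Y : α → ℝ} (hX : Measurable X) (hY : Measurable Y) {η : ℝ}
    (hη : 0 ≤ η) :
    ‖∫ u, Complex.exp ((X u : ℂ) * Complex.I) ∂μ - ∫ u, Complex.exp ((Y u : ℂ) * Complex.I) ∂μ‖ ≤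
      η + 2 * μ.real {u | η < |X u - Y u|} := by
  have hint : ∀ {X : α → ℝ}, Measurable X →
      Integrable (fun u => Complex.exp ((X u : ℂ) * Complex.I)) μ := fun hX =>
    Integrable.of_bound (by fun_prop) 1
      (Eventually.of_forall fun u => (Complex.norm_exp_ofReal_mul_I _).le)
  have hbad : MeasurableSet {u | η < |X u - Y u|} :=
    measurableSet_lt measurable_const (hX.sub hY).abs
  rw [← integral_sub (hint hX) (hint hY)]
  calc _ ≤ ∫ u, (η + {u | η < |X u - Y u|}.indicator (fun _ => (2 : ℝ)) u) ∂μ := by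
        refine norm_integral_le_of_norm_le ((integrable_const _).add
          ((integrable_const _).indicator hbad)) (Eventually.of_forall fun u => ?_)
        by_cases h : η < |X u - Y u|
        · rw [Set.indicator_of_mem (by exact h)]
          have := norm_sub_le (Complex.exp ((X u : ℂ) * Complex.I))
            (Complex.exp ((Y u : ℂ) * Complex.I))
          rw [Complex.norm_exp_ofReal_mul_I, Complex.norm_exp_ofReal_mul_I] at this
          linarith
        · rw [Set.indicator_of_notMem (by exact h), add_zero]
          exact (norm_cexp_sub_cexp_le _ _).trans (not_lt.1 h)
    _ = _ := by
        rw [integral_add (integrable_const _) ((integrable_const _).indicator hbad),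
          integral_indicator_const _ hbad]
        simp [mul_comm]

end CharFunComparison

section ConditionalCLT

variable {𝒵 : Type*} {d n : ℕ} {m : 𝒵 → EuclideanSpace ℝ (Fin d) → ℝ}
  {Θ : Set (EuclideanSpace ℝ (Fin d))} {ψ : 𝒵 → ℝ}

/-- The data `z` and the subsampling probabilities `p` are regular at `a` (with constants `K`, `c`,
`lam` and `r`): `a` is an interior point of `Θ`, the Hessian of the full-data objective is at most
`-lam`, the variance `Λ_{n,P}` is at least `c`, and the empirical moments that control the
subsampling error are at most `K`. -/
structure RegularSample (m : 𝒵 → EuclideanSpace ℝ (Fin d) → ℝ)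
    (Θ : Set (EuclideanSpace ℝ (Fin d))) (ψ : 𝒵 → ℝ) (K c lam r s : ℝ) (z : Fin n → 𝒵)
    (p : Fin n → ℝ) (a : EuclideanSpace ℝ (Fin d)) : Prop where
  ball : Metric.closedBall a r ⊆ Θ
  quad : ∀ v : EuclideanSpace ℝ (Fin d),
    ∑ k, (∑ l, hessN m z a k l * v l) * v k ≤ -(lam * ‖v‖ ^ 2)
  lam_ge : (lamP m s z p a - c • (1 : Matrix (Fin d) (Fin d) ℝ)).PosSemidef
  weight : ∀ i, ((n : ℝ) * p i)⁻¹ ≤ K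
  grad4 : (n : ℝ)⁻¹ * ∑ i, ‖WithLp.toLp 2 (grad (m (z i)) a)‖ ^ 4 ≤ K
  hess2 : ∀ k l, (n : ℝ)⁻¹ * ∑ i, hess (m (z i)) a k l ^ 2 ≤ K
  lip : (n : ℝ)⁻¹ * ∑ i, |ψ (z i)| ≤ K

/-- The Newton step for the subsample objective, with an explicit bound for the remainder on the
event that the subsample gradient, Hessian and Lipschitz constant are under control. -/
theorem abs_newton_remainder_le (hm_conc : ∀ z, ConcaveOn ℝ (convexHull ℝ Θ) (m z))
    (hm_smooth : ∀ z, ∀ θ ∈ Θ, ContDiffAt ℝ 2 (m z) θ)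
    (hH_lip : ∀ z, ∀ θ₁ ∈ Θ, ∀ θ₂ ∈ Θ, ∀ k l,
      |hess (m z) θ₁ k l - hess (m z) θ₂ k l| ≤ ψ z * ‖θ₁ - θ₂‖)
    {lam r : ℝ} {z : Fin n → 𝒵} {a b : EuclideanSpace ℝ (Fin d)}
    (hball : Metric.closedBall a r ⊆ Θ)
    (hquad : ∀ v : EuclideanSpace ℝ (Fin d),
      ∑ k, (∑ l, hessN m z a k l * v l) * v k ≤ -(lam * ‖v‖ ^ 2))
    {w : Fin n → ℝ} (hw : ∀ i, 0 ≤ w i) (hb : b ∈ Θ) (hmax : IsMaxOn (weightedObj m z w) Θ b)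
    {γ M ρ : ℝ} (hγ : 0 ≤ γ) (hlam : 0 < lam) (hρ : 0 < ρ) (hρr : ρ < r)
    (h1 : 2 * (d * γ) < lam / 2 * ρ) (h2 : 2 * (d ^ 2 * M * ρ) ≤ lam / 2)
    (h3 : d ^ 2 * γ ≤ lam / 2)
    (hG : ∀ k, |∑ i, w i * grad (m (z i)) a k| ≤ γ)
    (hHs : ∀ k l, |∑ i, w i * hess (m (z i)) a k l - hessN m z a k l| ≤ γ)
    (hL : ∑ i, w i * |ψ (z i)| ≤ M) (k : Fin d) :
    |∑ i, w i * grad (m (z i)) a k + ∑ l, hessN m z a k l * (b - a) l| ≤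
      d * M * (4 * (d * γ) / lam) ^ 2 + d * γ * (4 * (d * γ) / lam) := by
  have ha : a ∈ Θ := hball (Metric.mem_closedBall_self (hρ.trans hρr).le)
  have hsm : ∀ i, ContDiffAt ℝ 2 (m (z i)) a := fun i => hm_smooth _ _ ha
  have hsmooth : ∀ η ∈ Θ, ContDiffAt ℝ 2 (weightedObj m z w) η := fun η hη =>
    weightedObj_contDiffAt (fun i => hm_smooth _ _ hη) w
  have hM : 0 ≤ M := (Finset.sum_nonneg fun i _ => mul_nonneg (hw i) (abs_nonneg _)).trans hL
  have hlip : ∀ η ∈ Metric.closedBall a r, ∀ k l,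
      |hess (weightedObj m z w) η k l - hess (weightedObj m z w) a k l| ≤ M * ‖η - a‖ :=
    fun η hη k l => (abs_hess_weightedObj_sub_le hm_smooth hH_lip z hw (hball hη) ha k l).trans
      (by gcongr)
  have hq : ∀ v : EuclideanSpace ℝ (Fin d),
      ∑ k, (∑ l, hess (weightedObj m z w) a k l * v l) * v k ≤ -(lam / 2 * ‖v‖ ^ 2) := fun v => by
    refine (quadForm_le_of_abs_sub_le hquad (η := γ) (fun k l => ?_) v).trans ?_
    · rw [hess_weightedObj hsm]; exact hHs k l
    · have : 0 ≤ ‖v‖ ^ 2 := by positivity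
      nlinarith
  have hg : ∀ k, |grad (weightedObj m z w) a k| ≤ γ := fun k => by
    rw [grad_weightedObj hsm]; exact hG k
  have hba := norm_sub_lt_of_isMaxOn (weightedObj_concaveOn hm_conc z hw) hsmooth hball hM hlip hb
    hmax hq hg hρ hρr h1 h2
  obtain ⟨hn, hr⟩ := newton_expansion_of_isMaxOn hsmooth hball hM hlip hmax hq hg hρr h2 hba
  have hn' : ‖b - a‖ ≤ 4 * (d * γ) / lam := by
    rw [le_div_iff₀ hlam]; linarith
  have hrk := hr k
  rw [grad_weightedObj hsm] at hrk
  simp_rw [hess_weightedObj hsm] at hrk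
  have e : ∑ i, w i * grad (m (z i)) a k + ∑ l, hessN m z a k l * (b - a) l =
      (∑ i, w i * grad (m (z i)) a k + ∑ l, (∑ i, w i * hess (m (z i)) a k l) * (b - a) l) -
        ∑ l, (∑ i, w i * hess (m (z i)) a k l - hessN m z a k l) * (b - a) l := by
    simp_rw [sub_mul, Finset.sum_sub_distrib]
    ring
  rw [e]
  refine (abs_sub _ _).trans (add_le_add (hrk.trans ?_)
    ((abs_sum_mul_le (hHs k) (b - a)).trans ?_))
  · gcongr
  · gcongr

/-- The linearization of the normalized error, with `B = V^{-1/2} H⁻¹`. -/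
theorem dotProduct_normErr {s : ℝ} {z : Fin n → 𝒵} {p : Fin n → ℝ}
    {a b : EuclideanSpace ℝ (Fin d)} (hu : IsUnit (hessN m z a)) (G t : Fin d → ℝ) :
    t ⬝ᵥ normErr m s z p a b =
      Real.sqrt s * (t ⬝ᵥ (invSqrt (varP m s z p a) * (hessN m z a)⁻¹).mulVec
        (fun k => G k + ∑ l, hessN m z a k l * (b - a) l)) -
      Real.sqrt s * (Matrix.vecMul t (invSqrt (varP m s z p a) * (hessN m z a)⁻¹) ⬝ᵥ G) := by
  have h1 : (fun k => G k + ∑ l, hessN m z a k l * (b - a) l) =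
      G + (hessN m z a).mulVec (fun k => b k - a k) := by
    ext k
    simp [Matrix.mulVec, dotProduct]
  have h2 : (hessN m z a)⁻¹ * hessN m z a = 1 :=
    Matrix.nonsing_inv_mul _ ((Matrix.isUnit_iff_isUnit_det _).1 hu)
  rw [h1, Matrix.mulVec_add, Matrix.mulVec_mulVec, Matrix.mul_assoc, h2, Matrix.mul_one,
    dotProduct_add, ← Matrix.dotProduct_mulVec, normErr, dotProduct_smul, smul_eq_mul]
  ring

/-- The Lyapunov bound for the linear term of the normalized error. -/
theorem norm_integral_cexp_linear_sub_le {K c s : ℝ} (hK : 0 ≤ K) (hc : 0 < c) (hs : 1 ≤ s)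
    {z : Fin n → 𝒵} {p : Fin n → ℝ} {a : EuclideanSpace ℝ (Fin d)}
    (hp : ∀ i, 0 < p i) (hp1 : ∀ i, s * p i ≤ 1)
    {B : Matrix (Fin d) (Fin d) ℝ} (hB : B * lamP m s z p a * B.transpose = 1)
    (hlam_ge : (lamP m s z p a - c • (1 : Matrix (Fin d) (Fin d) ℝ)).PosSemidef)
    (hweight : ∀ i, ((n : ℝ) * p i)⁻¹ ≤ K)
    (hgrad4 : (n : ℝ)⁻¹ * ∑ i, ‖WithLp.toLp 2 (grad (m (z i)) a)‖ ^ 4 ≤ K)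
    (hmean : ∀ k, (n : ℝ)⁻¹ * ∑ i, grad (m (z i)) a k = 0) (t : Fin d → ℝ) :
    ‖∫ u, Complex.exp (((-(Real.sqrt s * (Matrix.vecMul t B ⬝ᵥ
        fun k => ∑ i, sampWeight s p u i * grad (m (z i)) a k)) : ℝ) : ℂ) * Complex.I)
          ∂(uniformLaw n) -
        Complex.exp ((-(‖WithLp.toLp 2 t‖ ^ 2 / 2) : ℝ) : ℂ)‖ ≤
      (5 * ((‖WithLp.toLp 2 t‖ / Real.sqrt c) ^ 3 * K ^ 2 * (1 + K)) +
        (‖WithLp.toLp 2 t‖ / Real.sqrt c) ^ 4 * K ^ 4) / Real.sqrt s := by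
  have hs0 : 0 < s := by linarith
  have hss : 0 < Real.sqrt s := Real.sqrt_pos.2 hs0
  have hsq : Real.sqrt s ^ 2 = s := Real.sq_sqrt hs0.le
  set τ := ‖WithLp.toLp 2 t‖ / Real.sqrt c with hτ
  have hτ0 : 0 ≤ τ := by positivity
  set y : Fin n → ℝ := fun i => Matrix.vecMul t B ⬝ᵥ grad (m (z i)) a with hy
  set κ : Fin n → ℝ := fun i => ((n : ℝ) * p i)⁻¹ with hκ
  have hκ0 : ∀ i, 0 ≤ κ i := fun i => by have := hp i; positivity
  set β : Fin n → ℝ := fun i => -(κ i / Real.sqrt s * y i) with hβ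
  -- centring the indicators is free, because the gradients sum to zero
  have hlin : ∀ u : Fin n → ℝ, -(Real.sqrt s * (Matrix.vecMul t B ⬝ᵥ
      fun k => ∑ i, sampWeight s p u i * grad (m (z i)) a k)) =
      ∑ i, β i * (selInd (s * p i) (u i) - s * p i) := fun u => by
    have e1 : (Matrix.vecMul t B ⬝ᵥ fun k => ∑ i, sampWeight s p u i * grad (m (z i)) a k) =
        ∑ i, sampWeight s p u i * y i := by
      simp only [dotProduct, Finset.mul_sum, hy]
      rw [Finset.sum_comm]
      exact Finset.sum_congr rfl fun i _ => Finset.sum_congr rfl fun k _ => by ring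
    have e2 : ∑ i, β i * (s * p i) = 0 := by
      have e3 : (n : ℝ)⁻¹ * ∑ i, y i = 0 := by
        have : ∑ i, y i = ∑ k, Matrix.vecMul t B k * ∑ i, grad (m (z i)) a k := by
          simp only [hy, dotProduct, Finset.mul_sum]
          rw [Finset.sum_comm]
        rw [this, Finset.mul_sum]
        refine Finset.sum_eq_zero fun k _ => ?_
        rw [mul_left_comm, hmean k, mul_zero]
      have e4 := sum_weight_mul_prob (n := n) hs0 hp y
      rw [e3] at e4
      rw [← mul_zero (-Real.sqrt s), ← e4, Finset.mul_sum]
      refine Finset.sum_congr rfl fun i _ => ?_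
      simp only [hβ, hκ]
      nth_rewrite 4 [← hsq]
      field_simp
    simp_rw [mul_sub, Finset.sum_sub_distrib]
    rw [e2, sub_zero, e1, Finset.mul_sum, ← Finset.sum_neg_distrib]
    refine Finset.sum_congr rfl fun i _ => ?_
    simp only [sampWeight, hβ, hκ]
    nth_rewrite 2 [← hsq]
    field_simp
  -- the variance of the linear term is the quadratic form of `Λ_{n,P}` at `Bᵀ t`
  have hvar : ∑ i, β i ^ 2 * (s * p i * (1 - s * p i)) = ‖WithLp.toLp 2 t‖ ^ 2 := by
    rw [norm_toLp_sq, ← quadForm_vecMul hB t, lamP_eq, quadForm_sum_vecMulVec]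
    refine Finset.sum_congr rfl fun i _ => ?_
    have := (hp i).ne'
    have := hss.ne'
    simp only [hβ, hκ, hy, neg_sq, mul_pow, div_pow, hsq, mul_inv]
    field_simp
  have hyb : ∀ i, |y i| ≤ τ * ‖WithLp.toLp 2 (grad (m (z i)) a)‖ := fun i => by
    have := abs_dotProduct_mulVec_le hB hc hlam_ge t (grad (m (z i)) a)
    rwa [Matrix.dotProduct_mulVec] at this
  have hβb : ∀ i, |β i| ≤ κ i / Real.sqrt s * (τ * ‖WithLp.toLp 2 (grad (m (z i)) a)‖) :=
    fun i => by
      rw [hβ, abs_neg, abs_mul, abs_of_nonneg (div_nonneg (hκ0 i) hss.le)]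
      have := hyb i
      have := hκ0 i
      gcongr
  have hκp : ∀ i, κ i * p i = (n : ℝ)⁻¹ := fun i => by
    have := (hp i).ne'
    simp only [hκ, mul_inv]
    field_simp
  have key := norm_integral_cexp_sum_sub_le (fun i => (mul_pos hs0 (hp i)).le) hp1 β
  rw [hvar] at key
  simp_rw [hlin]
  refine key.trans ?_
  rw [Finset.sum_add_distrib, ← Finset.mul_sum]
  set g : Fin n → ℝ := fun i => ‖WithLp.toLp 2 (grad (m (z i)) a)‖ with hgdef
  have hg0 : ∀ i, 0 ≤ g i := fun i => norm_nonneg _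
  have h3 : ∑ i, |β i| ^ 3 * (s * p i) ≤ τ ^ 3 * K ^ 2 * (1 + K) / Real.sqrt s := by
    have hterm : ∀ i, |β i| ^ 3 * (s * p i) ≤
        τ ^ 3 * K ^ 2 / Real.sqrt s * ((n : ℝ)⁻¹ * (1 + g i ^ 4)) := fun i => by
      have h0 := hp i
      have h1 : |β i| ^ 3 * (s * p i) ≤ (κ i / Real.sqrt s * (τ * g i)) ^ 3 * (s * p i) := by
        have := hβb i
        gcongr
      have h2 : (κ i / Real.sqrt s * (τ * g i)) ^ 3 * (s * p i) =
          τ ^ 3 * κ i ^ 2 / Real.sqrt s * ((n : ℝ)⁻¹ * g i ^ 3) := by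
        rw [← hκp i]
        nth_rewrite 2 [← hsq]
        field_simp
      have h4 : g i ^ 3 ≤ 1 + g i ^ 4 := by
        nlinarith [sq_nonneg (g i ^ 2 - g i), sq_nonneg (g i - 1), sq_nonneg (g i ^ 2 - 1)]
      rw [h2] at h1
      refine h1.trans ?_
      have := hκ0 i
      have := hweight i
      gcongr
    refine (Finset.sum_le_sum fun i _ => hterm i).trans ?_
    rw [← Finset.mul_sum, ← Finset.mul_sum, Finset.sum_add_distrib, mul_add]
    have h5 : (n : ℝ)⁻¹ * ∑ _i : Fin n, (1 : ℝ) ≤ 1 := by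
      simpa using inv_mul_le_one
    calc _ ≤ τ ^ 3 * K ^ 2 / Real.sqrt s * (1 + K) := by gcongr
      _ = _ := by ring
  have h4 : ∑ i, |β i| ^ 4 * (s * p i) ≤ τ ^ 4 * K ^ 4 / Real.sqrt s := by
    have hterm : ∀ i, |β i| ^ 4 * (s * p i) ≤
        τ ^ 4 * K ^ 3 / Real.sqrt s * ((n : ℝ)⁻¹ * g i ^ 4) := fun i => by
      have h0 := hp i
      have h1 : |β i| ^ 4 * (s * p i) ≤ (κ i / Real.sqrt s * (τ * g i)) ^ 4 * (s * p i) := by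
        have := hβb i
        gcongr
      have h2 : (κ i / Real.sqrt s * (τ * g i)) ^ 4 * (s * p i) =
          τ ^ 4 * κ i ^ 3 / s * ((n : ℝ)⁻¹ * g i ^ 4) := by
        rw [← hκp i]
        have : Real.sqrt s ^ 4 = s ^ 2 := by
          calc _ = (Real.sqrt s ^ 2) ^ 2 := by ring
            _ = s ^ 2 := by rw [hsq]
        rw [mul_pow, div_pow, this]
        field_simp
      rw [h2] at h1
      refine h1.trans ?_
      have := hκ0 i
      have := hweight i
      have hle : Real.sqrt s ≤ s := by
        nlinarith [Real.one_le_sqrt.2 hs]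
      have := hg0 i
      gcongr
    refine (Finset.sum_le_sum fun i _ => hterm i).trans ?_
    rw [← Finset.mul_sum, ← Finset.mul_sum]
    calc _ ≤ τ ^ 4 * K ^ 3 / Real.sqrt s * K := by gcongr
      _ = _ := by ring
  calc _ ≤ 5 * (τ ^ 3 * K ^ 2 * (1 + K) / Real.sqrt s) + τ ^ 4 * K ^ 4 / Real.sqrt s := by gcongr
    _ = _ := by ring

end ConditionalCLT

/-! ### The conditional central limit theorem over regular samples -/

section ConditionalCLTLimit

variable {𝒵 : Type*} {d : ℕ} {m : 𝒵 → EuclideanSpace ℝ (Fin d) → ℝ}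
  {Θ : Set (EuclideanSpace ℝ (Fin d))} {ψ : 𝒵 → ℝ}

/-- The conditional law of the normalized error, given the data. -/
noncomputable def normErrLaw {n : ℕ} (m : 𝒵 → EuclideanSpace ℝ (Fin d) → ℝ) (s : ℝ)
    (z : Fin n → 𝒵) (p : Fin n → ℝ) (a : EuclideanSpace ℝ (Fin d))
    (b : Finset (Fin n) → EuclideanSpace ℝ (Fin d)) : Measure (EuclideanSpace ℝ (Fin d)) :=
  (uniformLaw n).map fun u => WithLp.toLp 2 (normErr m s z p a (b (poissonSelect s p u)))

theorem measurable_toLp_normErr {n : ℕ} (s : ℝ)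
    (z : Fin n → 𝒵) (p : Fin n → ℝ) (a : EuclideanSpace ℝ (Fin d))
    (b : Finset (Fin n) → EuclideanSpace ℝ (Fin d)) :
    Measurable fun u => WithLp.toLp 2 (normErr m s z p a (b (poissonSelect s p u))) :=
  measurable_comp_poissonSelect s p fun S => WithLp.toLp 2 (normErr m s z p a (b S))

instance isProbabilityMeasure_normErrLaw {n : ℕ} (s : ℝ) (z : Fin n → 𝒵) (p : Fin n → ℝ)
    (a : EuclideanSpace ℝ (Fin d)) (b : Finset (Fin n) → EuclideanSpace ℝ (Fin d)) :
    IsProbabilityMeasure (normErrLaw m s z p a b) :=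
  Measure.isProbabilityMeasure_map (measurable_toLp_normErr s z p a b).aemeasurable

theorem charFun_normErrLaw {n : ℕ} (s : ℝ) (z : Fin n → 𝒵) (p : Fin n → ℝ)
    (a : EuclideanSpace ℝ (Fin d)) (b : Finset (Fin n) → EuclideanSpace ℝ (Fin d))
    (t : EuclideanSpace ℝ (Fin d)) :
    charFun (normErrLaw m s z p a b) t =
      ∫ u, Complex.exp (((t.ofLp ⬝ᵥ normErr m s z p a (b (poissonSelect s p u)) : ℝ) : ℂ) *
        Complex.I) ∂(uniformLaw n) := by
  rw [charFun_apply, normErrLaw, integral_map (measurable_toLp_normErr s z p a b).aemeasurable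
    (by fun_prop)]
  rfl

theorem condProb_eq_normErrLaw {n : ℕ} (s : ℝ) (z : Fin n → 𝒵) (p : Fin n → ℝ)
    (a : EuclideanSpace ℝ (Fin d)) (b : Finset (Fin n) → EuclideanSpace ℝ (Fin d))
    (x : Fin d → ℝ) :
    condProb s p {S | ∀ k, normErr m s z p a (b S) k ≤ x k} =
      (normErrLaw m s z p a b).real {y | ∀ k, y k ≤ x k} := by
  have hms : MeasurableSet {y : EuclideanSpace ℝ (Fin d) | ∀ k, y k ≤ x k} := by
    simp only [Set.ofPred_forall]
    exact MeasurableSet.iInter fun k => measurableSet_le (by fun_prop) measurable_const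
  rw [normErrLaw, map_measureReal_apply (measurable_toLp_normErr s z p a b) hms]
  rfl

theorem measureReal_iUnion_le_card_mul {α ι : Type*} [MeasurableSpace α] [Fintype ι] (μ : Measure α)
    (A : ι → Set α) {C : ℝ} (h : ∀ i, μ.real (A i) ≤ C) :
    μ.real (⋃ i, A i) ≤ Fintype.card ι * C := by
  refine (measureReal_iUnion_fintype_le _).trans ((Finset.sum_le_sum fun i _ => h i).trans ?_)
  simp

/-- The probability that the subsample gradient, Hessian or Lipschitz constant is out of control. -/
theorem uniformLaw_bad_le {n : ℕ} {K c lam r s : ℝ} {z : Fin n → 𝒵} {p : Fin n → ℝ}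
    {a : EuclideanSpace ℝ (Fin d)} (hs : 0 < s) (hp : ∀ i, 0 < p i) (hp1 : ∀ i, s * p i ≤ 1)
    (hK : 0 ≤ K) (hreg : RegularSample m Θ ψ K c lam r s z p a)
    (hmean : ∀ k, (n : ℝ)⁻¹ * ∑ i, grad (m (z i)) a k = 0) {M : ℝ} (hM : 0 < M) :
    (uniformLaw n).real {u | ¬ ((∀ k, |∑ i, sampWeight s p u i * grad (m (z i)) a k| ≤
        M / Real.sqrt s) ∧
      (∀ k l, |∑ i, sampWeight s p u i * hess (m (z i)) a k l - hessN m z a k l| ≤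
        M / Real.sqrt s) ∧ ∑ i, sampWeight s p u i * |ψ (z i)| ≤ M)} ≤
      d * (K * (1 + K) / M ^ 2) + d * (d * (K * K / M ^ 2)) + K / M := by
  have hg2 : ∀ k, (n : ℝ)⁻¹ * ∑ i, grad (m (z i)) a k ^ 2 ≤ 1 + K := fun k => by
    have h1 : ∀ i, grad (m (z i)) a k ^ 2 ≤ 1 + ‖WithLp.toLp 2 (grad (m (z i)) a)‖ ^ 4 := fun i => by
      have h := EuclideanSpace.abs_apply_le (WithLp.toLp 2 (grad (m (z i)) a)) k
      have h2 : grad (m (z i)) a k ^ 2 ≤ ‖WithLp.toLp 2 (grad (m (z i)) a)‖ ^ 2 :=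
        sq_le_sq' (abs_le.1 h).1 (abs_le.1 h).2
      nlinarith [sq_nonneg (‖WithLp.toLp 2 (grad (m (z i)) a)‖ ^ 2 - 1)]
    calc _ ≤ (n : ℝ)⁻¹ * ∑ i, (1 + ‖WithLp.toLp 2 (grad (m (z i)) a)‖ ^ 4) := by
          gcongr with i; exact h1 i
      _ = (n : ℝ)⁻¹ * n + (n : ℝ)⁻¹ * ∑ i, ‖WithLp.toLp 2 (grad (m (z i)) a)‖ ^ 4 := by
          rw [Finset.sum_add_distrib, mul_add]; simp
      _ ≤ 1 + K := add_le_add inv_mul_le_one hreg.grad4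
  have hA : ∀ k, (uniformLaw n).real {u | M / Real.sqrt s ≤
      |∑ i, sampWeight s p u i * grad (m (z i)) a k|} ≤ K * (1 + K) / M ^ 2 := fun k => by
    have := uniformLaw_sampWeight_ge_le hs hp hp1 hreg.weight (fun i => grad (m (z i)) a k) hM
    rw [hmean k] at this
    simp only [sub_zero] at this
    refine this.trans ?_
    have := hg2 k
    gcongr
  have hH : ∀ k l, (uniformLaw n).real {u | M / Real.sqrt s ≤
      |∑ i, sampWeight s p u i * hess (m (z i)) a k l - hessN m z a k l|} ≤ K * K / M ^ 2 :=
    fun k l => by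
      have := uniformLaw_sampWeight_ge_le hs hp hp1 hreg.weight (fun i => hess (m (z i)) a k l) hM
      simp_rw [hessN_apply]
      refine this.trans ?_
      have := hreg.hess2 k l
      gcongr
  have hL := uniformLaw_sampWeight_markov hs hp hp1 (a := fun i => |ψ (z i)|)
    (fun i => abs_nonneg _) hM
  have hL' := hL.trans (div_le_div_of_nonneg_right hreg.lip hM.le)
  have hA' := measureReal_iUnion_le_card_mul _ _ hA
  have hH' := measureReal_iUnion_le_card_mul _ _ fun k =>
    measureReal_iUnion_le_card_mul _ _ (hH k)
  rw [Fintype.card_fin] at hA' hH'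
  refine le_trans ?_ (add_le_add (add_le_add hA' hH') hL')
  refine le_trans (measureReal_mono ?_) ((measureReal_union_le _ _).trans
    (add_le_add_left (measureReal_union_le _ _) _))
  intro u hu
  simp only [Set.mem_ofPred_eq, not_and_or, not_forall, not_le] at hu
  simp only [Set.mem_union, Set.mem_iUnion, Set.mem_ofPred_eq]
  rcases hu with ⟨k, hk⟩ | ⟨k, l, hk⟩ | hk
  · exact Or.inl (Or.inl ⟨k, hk.le⟩)
  · exact Or.inl (Or.inr ⟨k, l, hk.le⟩)
  · exact Or.inr hk.le

/-- The characteristic function of the normalized error approaches the Gaussian one, uniformly over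
all regular samples, as the expected subsample size grows. -/
theorem charFun_normErrLaw_tendsto (hm_conc : ∀ z, ConcaveOn ℝ (convexHull ℝ Θ) (m z))
    (hm_smooth : ∀ z, ∀ θ ∈ Θ, ContDiffAt ℝ 2 (m z) θ)
    (hH_lip : ∀ z, ∀ θ₁ ∈ Θ, ∀ θ₂ ∈ Θ, ∀ k l,
      |hess (m z) θ₁ k l - hess (m z) θ₂ k l| ≤ ψ z * ‖θ₁ - θ₂‖)
    {K c lam r : ℝ} (hK : 0 ≤ K) (hc : 0 < c) (hlam : 0 < lam) (hr : 0 < r)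
    (t : EuclideanSpace ℝ (Fin d)) {ε : ℝ} (hε : 0 < ε) :
    ∃ N : ℝ, ∀ s, N ≤ s → ∀ (n : ℕ) (z : Fin n → 𝒵) (p : Fin n → ℝ)
      (a : EuclideanSpace ℝ (Fin d)) (b : Finset (Fin n) → EuclideanSpace ℝ (Fin d)),
      (∀ i, 0 < p i) → (∀ i, s * p i ≤ 1) → RegularSample m Θ ψ K c lam r s z p a →
      IsMaxOn (fullObj m z) Θ a → (∀ S, b S ∈ Θ) → (∀ S, IsMaxOn (subObj m z p S) Θ (b S)) →
      ‖charFun (normErrLaw m s z p a b) t -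
        charFun (stdGaussian (EuclideanSpace ℝ (Fin d))) t‖ ≤ ε := by
  -- `M` makes the exceptional event unlikely uniformly in `s`; afterwards `s` is taken large
  -- enough for the linearization and Lyapunov errors, which are of order `1 / √s` for fixed `M`
  obtain ⟨M, hM0, hM⟩ : ∃ M : ℝ, 0 < M ∧
      2 * (d * (K * (1 + K) / M ^ 2) + d * (d * (K * K / M ^ 2)) + K / M) ≤ ε / 3 := by
    have hlim : Tendsto (fun M : ℝ => 2 * (d * (K * (1 + K) / M ^ 2) + d * (d * (K * K / M ^ 2))
        + K / M)) atTop (𝓝 (2 * ((d : ℝ) * 0 + d * (d * 0) + 0))) := by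
      have h2 : ∀ C : ℝ, Tendsto (fun M : ℝ => C / M ^ 2) atTop (𝓝 0) := fun C =>
        (tendsto_pow_atTop (two_ne_zero)).const_div_atTop C
      exact ((((h2 _).const_mul _).add (((h2 _).const_mul _).const_mul _)).add
        (tendsto_id.const_div_atTop K)).const_mul 2
    simp only [mul_zero, add_zero] at hlim
    obtain ⟨M, h1, h2⟩ := ((hlim.eventually_lt_const (show (0 : ℝ) < ε / 3 by positivity)).and
      (eventually_gt_atTop 0)).exists
    exact ⟨M, h2, h1.le⟩
  -- the radius on which the localization lemma applies to the subsample objective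
  set ρ : ℝ := min (r / 2) (lam / (4 * (d ^ 2 * M + 1))) with hρdef
  have hρ : 0 < ρ := by positivity
  have hρr : ρ < r := (min_le_left _ _).trans_lt (half_lt_self hr)
  have hρ2 : 2 * (d ^ 2 * M * ρ) ≤ lam / 2 := by
    have h1 : ρ ≤ lam / (4 * (d ^ 2 * M + 1)) := min_le_right _ _
    have h2 : 0 < 4 * (d ^ 2 * M + 1) := by positivity
    rw [le_div_iff₀ h2] at h1
    nlinarith
  set τ : ℝ := ‖t‖ / Real.sqrt c with hτ
  have hτ0 : 0 ≤ τ := by positivity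
  set D : ℝ := d * M * (4 * (d * M) / lam) ^ 2 + d * M * (4 * (d * M) / lam) with hD
  have hD0 : 0 ≤ D := by positivity
  set C₁ : ℝ := τ * (d * D) with hC₁
  set C₂ : ℝ := 5 * (τ ^ 3 * K ^ 2 * (1 + K)) + τ ^ 4 * K ^ 4 with hC₂
  have hlim0 : ∀ C : ℝ, Tendsto (fun s : ℝ => C / Real.sqrt s) atTop (𝓝 0) := fun C =>
    Real.tendsto_sqrt_atTop.const_div_atTop C
  have hev : ∀ᶠ s : ℝ in atTop, 1 ≤ s ∧ C₁ / Real.sqrt s < ε / 3 ∧ C₂ / Real.sqrt s < ε / 3 ∧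
      2 * d * M / Real.sqrt s < lam / 2 * ρ ∧ d ^ 2 * M / Real.sqrt s < lam / 2 :=
    (eventually_ge_atTop 1).and (((hlim0 _).eventually_lt_const (by positivity)).and
      (((hlim0 _).eventually_lt_const (by positivity)).and
      (((hlim0 _).eventually_lt_const (by positivity)).and
      ((hlim0 _).eventually_lt_const (by positivity)))))
  obtain ⟨N, hN⟩ := eventually_atTop.1 hev
  refine ⟨N, fun s hNs n z p a b hp hp1 hreg ha_max hb hb_max => ?_⟩
  obtain ⟨hs1, hs2, hs3, hs4, hs5⟩ := hN s hNs
  have hs0 : 0 < s := by linarith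
  have hss : 0 < Real.sqrt s := Real.sqrt_pos.2 hs0
  have hsq : Real.sqrt s ^ 2 = s := Real.sq_sqrt hs0.le
  have ha : a ∈ Θ := hreg.ball (Metric.mem_closedBall_self hr.le)
  have hsm : ∀ i, ContDiffAt ℝ 2 (m (z i)) a := fun i => hm_smooth _ _ ha
  have hmean : ∀ k, (n : ℝ)⁻¹ * ∑ i, grad (m (z i)) a k = 0 := fun k => by
    rw [← grad_fullObj hsm, grad,
      fderiv_eq_zero_of_isMaxOn hreg.ball (by simpa using hr) ha_max]
    rfl
  have hu := isUnit_of_quadForm_neg hlam hreg.quad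
  have hHherm := hessN_isHermitian m hsm
  have hΛ := posDef_of_sub_smul_one hc hreg.lam_ge
  set B := invSqrt (varP m s z p a) * (hessN m z a)⁻¹ with hBdef
  have hB : B * lamP m s z p a * B.transpose = 1 :=
    standardize_mul_mul_transpose hHherm hu hΛ
  set G : (Fin n → ℝ) → Fin d → ℝ := fun u k => ∑ i, sampWeight s p u i * grad (m (z i)) a k
    with hG
  set X : (Fin n → ℝ) → ℝ := fun u => t.ofLp ⬝ᵥ normErr m s z p a (b (poissonSelect s p u))
    with hX
  set Y : (Fin n → ℝ) → ℝ := fun u => -(Real.sqrt s * (Matrix.vecMul t.ofLp B ⬝ᵥ G u)) with hY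
  have hXm : Measurable X :=
    measurable_comp_poissonSelect s p fun S => t.ofLp ⬝ᵥ normErr m s z p a (b S)
  have hYm : Measurable Y := by
    have : ∀ i, Measurable fun u : Fin n → ℝ => selInd (s * p i) (u i) := fun i =>
      (measurable_selInd _).comp (measurable_pi_apply i)
    simp only [hY, hG, dotProduct, sampWeight]
    fun_prop
  -- on the event that everything is under control, the linearization error is small
  have hclose : ∀ u, ((∀ k, |∑ i, sampWeight s p u i * grad (m (z i)) a k| ≤ M / Real.sqrt s) ∧
      (∀ k l, |∑ i, sampWeight s p u i * hess (m (z i)) a k l - hessN m z a k l| ≤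
        M / Real.sqrt s) ∧ ∑ i, sampWeight s p u i * |ψ (z i)| ≤ M) →
      |X u - Y u| ≤ C₁ / Real.sqrt s := by
    rintro u ⟨h1, h2, h3⟩
    have hrem := abs_newton_remainder_le hm_conc hm_smooth hH_lip hreg.ball hreg.quad
      (sampWeight_nonneg hs0 hp u) (hb _) (isMaxOn_weightedObj hs0 (hb_max (poissonSelect s p u)))
      (γ := M / Real.sqrt s) (by positivity) hlam hρ hρr
      (by calc _ = 2 * d * M / Real.sqrt s := by ring
            _ < _ := hs4) hρ2
      (by calc _ = d ^ 2 * M / Real.sqrt s := by ring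
            _ ≤ _ := hs5.le) h1 h2 h3
    set R : Fin d → ℝ := fun k => G u k +
      ∑ l, hessN m z a k l * (b (poissonSelect s p u) - a) l with hR
    have hRk : ∀ k, |R k| ≤ D / s := fun k => by
      refine (hrem k).trans (le_of_eq ?_)
      calc _ = D / Real.sqrt s ^ 2 := by rw [hD]; field_simp
        _ = D / s := by rw [hsq]
    have hRn : ‖WithLp.toLp 2 R‖ ≤ d * D / s := by
      refine (EuclideanSpace.norm_le_sum_abs _).trans ((Finset.sum_le_sum fun k _ => hRk k).trans ?_)
      simp [mul_div_assoc]
    have e : X u - Y u = Real.sqrt s * (t.ofLp ⬝ᵥ B.mulVec R) := by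
      simp only [hX, hY]
      rw [dotProduct_normErr hu (G u) t.ofLp]
      ring
    rw [e, abs_mul, abs_of_pos hss]
    have h4 := abs_dotProduct_mulVec_le hB hc hreg.lam_ge t.ofLp R
    calc _ ≤ Real.sqrt s * (τ * (d * D / s)) := by
          gcongr
          refine h4.trans ?_
          rw [hτ]
          gcongr
      _ = C₁ / Real.sqrt s := by
          rw [hC₁]
          nth_rewrite 2 [← hsq]
          field_simp
  have hC₁0 : 0 ≤ C₁ := by positivity
  have hcmp := norm_integral_cexp_sub_le (μ := uniformLaw n) hXm hYm
    (η := C₁ / Real.sqrt s) (by positivity)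
  have hbad : (uniformLaw n).real {u | C₁ / Real.sqrt s < |X u - Y u|} ≤
      d * (K * (1 + K) / M ^ 2) + d * (d * (K * K / M ^ 2)) + K / M := by
    refine le_trans (measureReal_mono ?_) (uniformLaw_bad_le hs0 hp hp1 hK hreg hmean hM0)
    exact fun u hu hgood => absurd (hclose u hgood) (not_le.2 hu)
  have hlin := norm_integral_cexp_linear_sub_le hK hc hs1 hp hp1 hB hreg.lam_ge hreg.weight
    hreg.grad4 hmean t.ofLp
  have hgauss : charFun (stdGaussian (EuclideanSpace ℝ (Fin d))) t =
      Complex.exp ((-(‖t‖ ^ 2 / 2) : ℝ) : ℂ) := by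
    rw [charFun_stdGaussian]
    push_cast
    ring_nf
  rw [charFun_normErrLaw, hgauss]
  refine (norm_sub_le_norm_sub_add_norm_sub _ (∫ u, Complex.exp ((Y u : ℂ) * Complex.I)
    ∂(uniformLaw n)) _).trans ?_
  have hlin' : ‖∫ u, Complex.exp ((Y u : ℂ) * Complex.I) ∂(uniformLaw n) -
      Complex.exp ((-(‖t‖ ^ 2 / 2) : ℝ) : ℂ)‖ ≤ C₂ / Real.sqrt s := hlin
  linarith

/-- The conditional central limit theorem, uniformly over all regular samples. -/
theorem condProb_tendsto (hm_conc : ∀ z, ConcaveOn ℝ (convexHull ℝ Θ) (m z))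
    (hm_smooth : ∀ z, ∀ θ ∈ Θ, ContDiffAt ℝ 2 (m z) θ)
    (hH_lip : ∀ z, ∀ θ₁ ∈ Θ, ∀ θ₂ ∈ Θ, ∀ k l,
      |hess (m z) θ₁ k l - hess (m z) θ₂ k l| ≤ ψ z * ‖θ₁ - θ₂‖)
    {K c lam r : ℝ} (hK : 0 ≤ K) (hc : 0 < c) (hlam : 0 < lam) (hr : 0 < r)
    (x : Fin d → ℝ) {δ : ℝ} (hδ : 0 < δ) :
    ∃ N : ℝ, ∀ s, N ≤ s → ∀ (n : ℕ) (z : Fin n → 𝒵) (p : Fin n → ℝ)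
      (a : EuclideanSpace ℝ (Fin d)) (b : Finset (Fin n) → EuclideanSpace ℝ (Fin d)),
      (∀ i, 0 < p i) → (∀ i, s * p i ≤ 1) → RegularSample m Θ ψ K c lam r s z p a →
      IsMaxOn (fullObj m z) Θ a → (∀ S, b S ∈ Θ) → (∀ S, IsMaxOn (subObj m z p S) Θ (b S)) →
      |condProb s p {S | ∀ k, normErr m s z p a (b S) k ≤ x k} -
        (stdGaussian (EuclideanSpace ℝ (Fin d))).real {y | ∀ k, y k ≤ x k}| < δ := by
  obtain ⟨N, hN⟩ := orthant_tendsto_of_charFun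
    (fun s => {μ | ∃ (n : ℕ) (z : Fin n → 𝒵) (p : Fin n → ℝ)
      (a : EuclideanSpace ℝ (Fin d)) (b : Finset (Fin n) → EuclideanSpace ℝ (Fin d)),
      (∀ i, 0 < p i) ∧ (∀ i, s * p i ≤ 1) ∧ RegularSample m Θ ψ K c lam r s z p a ∧
      IsMaxOn (fullObj m z) Θ a ∧ (∀ S, b S ∈ Θ) ∧ (∀ S, IsMaxOn (subObj m z p S) Θ (b S)) ∧
      μ = normErrLaw m s z p a b})
    (by rintro s μ ⟨n, z, p, a, b, -, -, -, -, -, -, rfl⟩; infer_instance)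
    (fun t ε hε => by
      obtain ⟨N, hN⟩ := charFun_normErrLaw_tendsto hm_conc hm_smooth hH_lip hK hc hlam hr t hε
      refine ⟨N, ?_⟩
      rintro s hs μ ⟨n, z, p, a, b, h1, h2, h3, h4, h5, h6, rfl⟩
      exact hN s hs n z p a b h1 h2 h3 h4 h5 h6) x hδ
  refine ⟨N, fun s hs n z p a b h1 h2 h3 h4 h5 h6 => ?_⟩
  rw [condProb_eq_normErrLaw]
  exact hN s hs _ ⟨n, z, p, a, b, h1, h2, h3, h4, h5, h6, rfl⟩

end ConditionalCLTLimit

/-! ### Laws of large numbers and the population first-order condition -/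

section Measurability

variable {𝒵 : Type*} [MeasurableSpace 𝒵] {d : ℕ}

theorem measurable_fderiv_apply {F : 𝒵 → EuclideanSpace ℝ (Fin d) → ℝ}
    {θ : EuclideanSpace ℝ (Fin d)} {r : ℝ} (hr : 0 < r)
    (hF : ∀ η ∈ Metric.closedBall θ r, Measurable fun z => F z η)
    (hd : ∀ z, DifferentiableAt ℝ (F z) θ) (v : EuclideanSpace ℝ (Fin d)) :
    Measurable fun z => fderiv ℝ (F z) θ v := by
  -- difference quotients with steps small enough to stay in the ball where `F` is measurable
  set c : ℕ → ℝ := fun j => j + (1 + ‖v‖ / r) with hc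
  have hc0 : ∀ j, 0 < c j := fun j => by positivity
  have hct : Tendsto c atTop atTop :=
    tendsto_atTop_add_const_right _ _ tendsto_natCast_atTop_atTop
  refine measurable_of_tendsto_metrizable
    (f := fun j z => c j • (F z (θ + (c j)⁻¹ • v) - F z θ)) (fun j => ?_)
    (tendsto_pi_nhds.2 fun z => (hd z).hasFDerivAt.lim v (tendsto_norm_atTop_atTop.comp hct))
  refine ((hF _ ?_).sub (hF _ (Metric.mem_closedBall_self hr.le))).const_smul (c j)
  rw [Metric.mem_closedBall, dist_eq_norm, add_sub_cancel_left, norm_smul, norm_inv,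
    Real.norm_eq_abs, abs_of_pos (hc0 j), inv_mul_le_iff₀ (hc0 j)]
  have : ‖v‖ / r * r = ‖v‖ := div_mul_cancel₀ _ hr.ne'
  have h1 : 0 ≤ (j : ℝ) * r := by positivity
  calc ‖v‖ = ‖v‖ / r * r := this.symm
    _ ≤ c j * r := by rw [hc]; nlinarith

variable {m : 𝒵 → EuclideanSpace ℝ (Fin d) → ℝ} {Θ : Set (EuclideanSpace ℝ (Fin d))}

theorem measurable_grad (hm_meas : ∀ θ, Measurable fun z => m z θ)
    (hm_smooth : ∀ z, ∀ θ ∈ Θ, ContDiffAt ℝ 2 (m z) θ) {θ : EuclideanSpace ℝ (Fin d)}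
    (hθ : θ ∈ Θ) (k : Fin d) : Measurable fun z => grad (m z) θ k :=
  measurable_fderiv_apply one_pos (fun η _ => hm_meas η)
    (fun z => (hm_smooth z θ hθ).differentiableAt (by norm_num)) _

theorem measurable_hess (hm_meas : ∀ θ, Measurable fun z => m z θ)
    (hm_smooth : ∀ z, ∀ θ ∈ Θ, ContDiffAt ℝ 2 (m z) θ) {θ : EuclideanSpace ℝ (Fin d)} {r : ℝ}
    (hr : 0 < r) (hball : Metric.closedBall θ r ⊆ Θ) (k l : Fin d) :
    Measurable fun z => hess (m z) θ k l :=
  measurable_fderiv_apply (F := fun z η => grad (m z) η k) hr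
    (fun _ hη => measurable_grad hm_meas hm_smooth (hball hη) k)
    (fun z => (hm_smooth z θ (hball (Metric.mem_closedBall_self hr.le))).differentiableAt_grad k) _

end Measurability

section LawOfLargeNumbers

variable {Ω 𝒵 : Type*} [MeasurableSpace Ω] [MeasurableSpace 𝒵] {P : Measure Ω}
  {Z : ℕ → Ω → 𝒵}

/-- The weak law of large numbers for a function of the data. -/
theorem tendsto_measure_abs_avg_sub_ge [IsProbabilityMeasure P]
    (hZ_meas : ∀ i, Measurable (Z i))
    (hZ_indep : iIndepFun Z P) (hZ_ident : ∀ i, IdentDistrib (Z i) (Z 0) P P) {φ : 𝒵 → ℝ}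
    (hφ : Measurable φ) (hint : Integrable (fun ω => φ (Z 0 ω)) P) {η : ℝ} (hη : 0 < η) :
    Tendsto (fun n : ℕ => P {ω | η ≤ |(n : ℝ)⁻¹ * ∑ i : Fin n, φ (dataSet Z n ω i) -
      ∫ ω, φ (Z 0 ω) ∂P|}) atTop (𝓝 0) := by
  have h := strong_law_ae_real (fun i ω => φ (Z i ω)) hint
    (fun i j hij => (hZ_indep.indepFun hij).comp hφ hφ) (fun i => (hZ_ident i).comp hφ)
  have h2 : TendstoInMeasure P (fun (n : ℕ) ω => (∑ i ∈ Finset.range n, φ (Z i ω)) / n) atTop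
      (fun _ => ∫ ω, φ (Z 0 ω) ∂P) :=
    tendstoInMeasure_of_tendsto_ae (fun n => by
      have : ∀ i, Measurable fun ω => φ (Z i ω) := fun i => hφ.comp (hZ_meas i)
      exact ((Finset.measurable_fun_sum _ fun i _ => this i).div_const _).aestronglyMeasurable) h
  have h3 := tendstoInMeasure_iff_dist.1 h2 η hη
  refine h3.congr fun n => ?_
  congr 1
  ext ω
  simp only [Set.mem_ofPred_eq, Real.dist_eq, dataSet]
  rw [Finset.sum_range, div_eq_inv_mul]

theorem tendsto_measure_union_zero {A B : ℕ → Set Ω} (hA : Tendsto (fun n => P (A n)) atTop (𝓝 0))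
    (hB : Tendsto (fun n => P (B n)) atTop (𝓝 0)) :
    Tendsto (fun n => P (A n ∪ B n)) atTop (𝓝 0) :=
  tendsto_of_tendsto_of_tendsto_of_le_of_le tendsto_const_nhds (by simpa using hA.add hB)
    (fun _ => zero_le) fun _ => measure_union_le _ _

theorem tendsto_measure_iUnion_zero {ι : Type*} [Fintype ι] {A : ι → ℕ → Set Ω}
    (hA : ∀ i, Tendsto (fun n => P (A i n)) atTop (𝓝 0)) :
    Tendsto (fun n => P (⋃ i, A i n)) atTop (𝓝 0) :=
  tendsto_of_tendsto_of_tendsto_of_le_of_le tendsto_const_nhds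
    (by simpa using tendsto_finsetSum Finset.univ fun i _ => hA i)
    (fun _ => zero_le) fun _ => measure_iUnion_fintype_le _ _

end LawOfLargeNumbers

section Population

variable {Ω 𝒵 : Type*} [MeasurableSpace Ω] {P : Measure Ω} {d : ℕ} {m : 𝒵 → EuclideanSpace ℝ (Fin d) → ℝ}
  {Θ : Set (EuclideanSpace ℝ (Fin d))} {ψ : 𝒵 → ℝ}

/-- The first-order condition at an interior maximizer of the expected objective. It follows from
the expectation of a Taylor expansion with integrable remainder, without a derivative of the
expected objective. -/
theorem integral_grad_eq_zero (hm_smooth : ∀ z, ∀ θ ∈ Θ, ContDiffAt ℝ 2 (m z) θ)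
    (hH_lip : ∀ z, ∀ θ₁ ∈ Θ, ∀ θ₂ ∈ Θ, ∀ k l,
      |hess (m z) θ₁ k l - hess (m z) θ₂ k l| ≤ ψ z * ‖θ₁ - θ₂‖)
    {X : Ω → 𝒵} {θ₀ : EuclideanSpace ℝ (Fin d)} {r : ℝ} (hr : 0 < r)
    (hball : Metric.closedBall θ₀ r ⊆ Θ)
    (hm_int : ∀ θ ∈ Θ, Integrable (fun ω => m (X ω) θ) P)
    (hmax : ∀ θ ∈ Θ, ∫ ω, m (X ω) θ ∂P ≤ ∫ ω, m (X ω) θ₀ ∂P)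
    (hG_int : ∀ k, Integrable (fun ω => grad (m (X ω)) θ₀ k) P)
    (hH_int : ∀ k l, Integrable (fun ω => hess (m (X ω)) θ₀ k l) P)
    (hψ_int : Integrable (fun ω => ψ (X ω)) P) (k : Fin d) :
    ∫ ω, grad (m (X ω)) θ₀ k ∂P = 0 := by
  have hθ₀ : θ₀ ∈ Θ := hball (Metric.mem_closedBall_self hr.le)
  set Q : 𝒵 → ℝ := fun z => ∑ k, ∑ l, |hess (m z) θ₀ k l| + d * |ψ z| * r with hQ
  have hQ0 : ∀ z, 0 ≤ Q z := fun z => by positivity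
  have hQ_int : Integrable (fun ω => Q (X ω)) P :=
    (integrable_finsetSum _ fun k _ => integrable_finsetSum _ fun l _ => (hH_int k l).abs).add
      ((hψ_int.abs.const_mul _).mul_const _)
  have htaylor : ∀ z, ∀ v : EuclideanSpace ℝ (Fin d), ‖v‖ ≤ r →
      |m z (θ₀ + v) - m z θ₀ - ∑ k, grad (m z) θ₀ k * v k| ≤ d * (Q z * ‖v‖) * ‖v‖ := by
    intro z v hv
    have hsub : ∀ {η}, η ∈ Metric.closedBall θ₀ ‖v‖ → η ∈ Θ := fun {η} hη =>
      hball (Metric.closedBall_subset_closedBall hv hη)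
    have key := abs_sub_sub_grad_le (f := m z) (a := θ₀) (b := θ₀ + v) (C := Q z * ‖v‖)
      (mul_nonneg (hQ0 z) (norm_nonneg _))
      (fun η hη => (hm_smooth z η (hsub (by simpa using hη))).differentiableAt (by norm_num))
      (fun η hη k => ?_)
    · simpa using key
    · have hηn : ‖η - θ₀‖ ≤ ‖v‖ := by simpa [dist_eq_norm] using hη
      have hsub' : ∀ {ξ}, ξ ∈ Metric.closedBall θ₀ ‖η - θ₀‖ → ξ ∈ Θ := fun {ξ} hξ =>
        hsub (Metric.closedBall_subset_closedBall hηn hξ)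
      have h1 := abs_grad_sub_le (f := m z) (a := θ₀) (b := η) (L := |ψ z|) (abs_nonneg _)
        (fun ξ hξ => hm_smooth z ξ (hsub' hξ)) (fun ξ hξ k l =>
          (hH_lip z ξ (hsub' hξ) θ₀ hθ₀ k l).trans (by gcongr; exact le_abs_self _)) k
      have h2 : |∑ l, hess (m z) θ₀ k l * (η - θ₀) l| ≤
          (∑ k, ∑ l, |hess (m z) θ₀ k l|) * ‖η - θ₀‖ := by
        refine (Finset.abs_sum_le_sum_abs _ _).trans ?_
        have h3 : ∑ l, |hess (m z) θ₀ k l| ≤ ∑ k, ∑ l, |hess (m z) θ₀ k l| :=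
          Finset.single_le_sum (f := fun k => ∑ l, |hess (m z) θ₀ k l|)
            (fun k _ => Finset.sum_nonneg fun l _ => abs_nonneg _) (Finset.mem_univ k)
        refine le_trans ?_ (mul_le_mul_of_nonneg_right h3 (norm_nonneg _))
        rw [Finset.sum_mul]
        refine Finset.sum_le_sum fun l _ => ?_
        rw [abs_mul]
        exact mul_le_mul_of_nonneg_left (EuclideanSpace.abs_apply_le _ _) (abs_nonneg _)
      have h4 : |grad (m z) η k - grad (m z) θ₀ k| ≤
          (∑ k, ∑ l, |hess (m z) θ₀ k l|) * ‖η - θ₀‖ + d * |ψ z| * ‖η - θ₀‖ ^ 2 := by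
        have := abs_add_le (∑ l, hess (m z) θ₀ k l * (η - θ₀) l)
          (grad (m z) η k - grad (m z) θ₀ k - ∑ l, hess (m z) θ₀ k l * (η - θ₀) l)
        rw [add_sub_cancel] at this
        linarith
      refine h4.trans ?_
      have h5 : ‖η - θ₀‖ ^ 2 ≤ r * ‖v‖ := by
        rw [sq]; exact mul_le_mul (hηn.trans hv) hηn (norm_nonneg _) hr.le
      calc _ ≤ (∑ k, ∑ l, |hess (m z) θ₀ k l|) * ‖v‖ + d * |ψ z| * (r * ‖v‖) := by gcongr
        _ = Q z * ‖v‖ := by rw [hQ]; ring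
  -- the expected directional derivative is nonpositive in every direction
  have hdir : ∀ v : EuclideanSpace ℝ (Fin d), ‖v‖ = 1 →
      ∫ ω, ∑ k, grad (m (X ω)) θ₀ k * v k ∂P ≤ 0 := by
    intro v hv
    have hlin_int : Integrable (fun ω => ∑ k, grad (m (X ω)) θ₀ k * v k) P :=
      integrable_finsetSum _ fun k _ => (hG_int k).mul_const _
    have hbound : ∀ τ : ℝ, 0 < τ → τ ≤ r →
        ∫ ω, ∑ k, grad (m (X ω)) θ₀ k * v k ∂P ≤ d * (∫ ω, Q (X ω) ∂P) * τ := by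
      intro τ hτ hτr
      have hn : ‖τ • v‖ = τ := by rw [norm_smul, hv, mul_one, Real.norm_eq_abs, abs_of_pos hτ]
      have hmem : θ₀ + τ • v ∈ Θ := hball (by simpa [dist_eq_norm, hn] using hτr)
      have h1 : ∫ ω, (τ * (∑ k, grad (m (X ω)) θ₀ k * v k) - d * τ ^ 2 * Q (X ω)) ∂P ≤
          ∫ ω, (m (X ω) (θ₀ + τ • v) - m (X ω) θ₀) ∂P := by
        refine integral_mono ((hlin_int.const_mul _).sub (hQ_int.const_mul _))
          ((hm_int _ hmem).sub (hm_int _ hθ₀)) fun ω => ?_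
        have := (abs_le.1 (htaylor (X ω) (τ • v) (hn.le.trans hτr))).1
        rw [hn] at this
        have e : ∑ k, grad (m (X ω)) θ₀ k * (τ • v) k =
            τ * ∑ k, grad (m (X ω)) θ₀ k * v k := by
          rw [Finset.mul_sum]
          exact Finset.sum_congr rfl fun k _ => by simp; ring
        rw [e] at this
        simp only
        linarith
      rw [integral_sub (hlin_int.const_mul _) (hQ_int.const_mul _), integral_const_mul,
        integral_const_mul, integral_sub (hm_int _ hmem) (hm_int _ hθ₀)] at h1
      have h2 := hmax _ hmem
      have h3 : τ * (∫ ω, ∑ k, grad (m (X ω)) θ₀ k * v k ∂P) ≤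
          τ * (d * (∫ ω, Q (X ω) ∂P) * τ) := by linarith
      exact le_of_mul_le_mul_left h3 hτ
    have hlim : Tendsto (fun τ : ℝ => d * (∫ ω, Q (X ω) ∂P) * τ) (𝓝[>] 0) (𝓝 0) := by
      have : Tendsto (fun τ : ℝ => d * (∫ ω, Q (X ω) ∂P) * τ) (𝓝 0)
          (𝓝 (d * (∫ ω, Q (X ω) ∂P) * 0)) := tendsto_id.const_mul _
      rw [mul_zero] at this
      exact this.mono_left nhdsWithin_le_nhds
    refine ge_of_tendsto hlim ?_
    filter_upwards [Ioc_mem_nhdsGT hr] with τ hτ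
    exact hbound τ hτ.1 hτ.2
  have h1 := hdir (EuclideanSpace.single k 1) (by simp)
  have h2 := hdir (-EuclideanSpace.single k 1) (by simp)
  have e : ∀ f : Fin d → ℝ, ∑ j, f j * (EuclideanSpace.single k (1 : ℝ)) j = f k := fun f => by
    simp
  simp only [PiLp.neg_apply, mul_neg, Finset.sum_neg_distrib, e, integral_neg] at h1 h2
  linarith

/-- A positive definite matrix is bounded below by a positive multiple of the identity. -/
theorem exists_quadForm_le_of_neg_posDef {H : Matrix (Fin d) (Fin d) ℝ} (hH : (-H).PosDef) :
    ∃ lam : ℝ, 0 < lam ∧ ∀ v : EuclideanSpace ℝ (Fin d),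
      ∑ k, (∑ l, H k l * v l) * v k ≤ -(lam * ‖v‖ ^ 2) := by
  set q : EuclideanSpace ℝ (Fin d) → ℝ := fun v => ∑ k, (∑ l, H k l * v l) * v k with hq
  have hqc : Continuous q := by simp only [hq]; fun_prop
  have hneg : ∀ v, v ≠ 0 → q v < 0 := fun v hv => by
    have := hH.dotProduct_mulVec_pos (x := v.ofLp) (by simpa using hv)
    rw [star_trivial, Matrix.neg_mulVec, dotProduct_neg, dotProduct_comm] at this
    exact neg_pos.1 this
  have hhom : ∀ (τ : ℝ) v, q (τ • v) = τ ^ 2 * q v := fun τ v => by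
    simp only [hq, Finset.mul_sum, Finset.sum_mul]
    exact Finset.sum_congr rfl fun k _ => Finset.sum_congr rfl fun l _ => by simp; ring
  rcases (Metric.sphere (0 : EuclideanSpace ℝ (Fin d)) 1).eq_empty_or_nonempty with h | h
  · refine ⟨1, one_pos, fun v => ?_⟩
    by_cases hv : v = 0
    · simp [hv]
    · have : ‖v‖⁻¹ • v ∈ Metric.sphere (0 : EuclideanSpace ℝ (Fin d)) 1 := by
        simp [norm_smul, hv]
      rw [h] at this
      exact absurd this (Set.notMem_empty _)
  · obtain ⟨w, hw, hmax⟩ := (isCompact_sphere _ _).exists_isMaxOn h hqc.continuousOn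
    have hw1 : ‖w‖ = 1 := by simpa using hw
    refine ⟨-q w, neg_pos.2 (hneg w (by rintro rfl; simp at hw1)), fun v => ?_⟩
    by_cases hv : v = 0
    · simp [hv]
    · have hvn : 0 < ‖v‖ := norm_pos_iff.2 hv
      have h1 : q (‖v‖⁻¹ • v) ≤ q w := hmax (by simp [norm_smul, hv])
      rw [hhom, inv_pow, inv_mul_le_iff₀ (by positivity)] at h1
      change q v ≤ _
      linarith

end Population

/-! ### Regularity of the sample in probability -/

section RegularityInProbability

variable {𝒵 : Type*} {d n : ℕ} {m : 𝒵 → EuclideanSpace ℝ (Fin d) → ℝ}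
  {Θ : Set (EuclideanSpace ℝ (Fin d))} {ψ : 𝒵 → ℝ}

/-- The sample is typical for the laws of large numbers at `θ₀`: the empirical means of the
gradient and of the Hessian are within `η` of `0` and of `H`, and those of `|ψ|`, `ψ²` and of the
squared Hessian entries are at most `K`. -/
structure TypicalSample (m : 𝒵 → EuclideanSpace ℝ (Fin d) → ℝ) (ψ : 𝒵 → ℝ)
    (θ₀ : EuclideanSpace ℝ (Fin d)) (H : Matrix (Fin d) (Fin d) ℝ) (η K : ℝ)
    (z : Fin n → 𝒵) : Prop where
  grad_mean : ∀ k, |(n : ℝ)⁻¹ * ∑ i, grad (m (z i)) θ₀ k| ≤ η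
  hess_mean : ∀ k l, |(n : ℝ)⁻¹ * ∑ i, hess (m (z i)) θ₀ k l - H k l| ≤ η
  lip : (n : ℝ)⁻¹ * ∑ i, |ψ (z i)| ≤ K
  lip2 : (n : ℝ)⁻¹ * ∑ i, ψ (z i) ^ 2 ≤ K
  hess2 : ∀ k l, (n : ℝ)⁻¹ * ∑ i, hess (m (z i)) θ₀ k l ^ 2 ≤ K

/-- For a typical sample, the full-data estimator lies close to `θ₀`, and inherits from it the
curvature and the moment bounds. -/
theorem TypicalSample.bounds (hm_conc : ∀ z, ConcaveOn ℝ (convexHull ℝ Θ) (m z))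
    (hm_smooth : ∀ z, ∀ θ ∈ Θ, ContDiffAt ℝ 2 (m z) θ)
    (hH_lip : ∀ z, ∀ θ₁ ∈ Θ, ∀ θ₂ ∈ Θ, ∀ k l,
      |hess (m z) θ₁ k l - hess (m z) θ₂ k l| ≤ ψ z * ‖θ₁ - θ₂‖)
    {θ₀ a : EuclideanSpace ℝ (Fin d)} {r lam η K ρ : ℝ} {H : Matrix (Fin d) (Fin d) ℝ}
    {z : Fin n → 𝒵} (hball : Metric.closedBall θ₀ r ⊆ Θ) (hK : 0 ≤ K)
    (hquad : ∀ v : EuclideanSpace ℝ (Fin d),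
      ∑ k, (∑ l, H k l * v l) * v k ≤ -(lam * ‖v‖ ^ 2))
    (ha : a ∈ Θ) (hmax : IsMaxOn (fullObj m z) Θ a) (hρ : 0 < ρ) (hρr : 2 * ρ < r)
    (h1 : 2 * (d * η) < lam / 2 * ρ) (h2 : 4 * (d ^ 2 * K * ρ) ≤ lam)
    (h3 : 2 * (d ^ 2 * η) ≤ lam) (hz : TypicalSample m ψ θ₀ H η K z) :
    Metric.closedBall a ρ ⊆ Θ ∧
      (∀ v : EuclideanSpace ℝ (Fin d),
        ∑ k, (∑ l, hessN m z a k l * v l) * v k ≤ -(lam / 4 * ‖v‖ ^ 2)) ∧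
      ∀ k l, (n : ℝ)⁻¹ * ∑ i, hess (m (z i)) a k l ^ 2 ≤ 2 * K + 2 * ρ ^ 2 * K := by
  have hr : 0 < r := by linarith
  have hθ₀ : θ₀ ∈ Θ := hball (Metric.mem_closedBall_self hr.le)
  have hw : ∀ _i : Fin n, (0 : ℝ) ≤ (n : ℝ)⁻¹ := fun _ => by positivity
  have hsm₀ : ∀ i, ContDiffAt ℝ 2 (m (z i)) θ₀ := fun i => hm_smooth _ _ hθ₀
  have hlip : ∀ ξ ∈ Θ, ∀ k l,
      |hess (fullObj m z) ξ k l - hess (fullObj m z) θ₀ k l| ≤ K * ‖ξ - θ₀‖ := by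
    intro ξ hξ k l
    rw [fullObj_eq]
    refine (abs_hess_weightedObj_sub_le hm_smooth hH_lip z hw hξ hθ₀ k l).trans ?_
    rw [← Finset.mul_sum]
    exact mul_le_mul_of_nonneg_right hz.lip (norm_nonneg _)
  have hq := fun v => quadForm_le_of_abs_sub_le hquad (H' := hessN m z θ₀) (η := η)
    (fun k l => by rw [hessN_apply]; exact hz.hess_mean k l) v
  have hq' : ∀ v : EuclideanSpace ℝ (Fin d),
      ∑ k, (∑ l, hess (fullObj m z) θ₀ k l * v l) * v k ≤ -(lam / 2 * ‖v‖ ^ 2) := fun v => by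
    simp_rw [hess_fullObj hsm₀]
    refine (hq v).trans ?_
    have : 0 ≤ ‖v‖ ^ 2 := by positivity
    nlinarith
  have hdist : ‖a - θ₀‖ < ρ := by
    refine norm_sub_lt_of_isMaxOn (f := fullObj m z) ?_ ?_ hball hK
      (fun ξ hξ => hlip ξ (hball hξ)) ha hmax hq' (γ := η) ?_ hρ (by linarith) h1 (by linarith)
    · rw [fullObj_eq]; exact weightedObj_concaveOn hm_conc z hw
    · intro ξ hξ
      rw [fullObj_eq]; exact weightedObj_contDiffAt (fun i => hm_smooth _ _ hξ) _
    · intro k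
      rw [grad_fullObj hsm₀]; exact hz.grad_mean k
  refine ⟨fun ξ hξ => hball ?_, fun v => ?_, fun k l => ?_⟩
  · rw [Metric.mem_closedBall, dist_eq_norm] at hξ ⊢
    have := norm_add_le (ξ - a) (a - θ₀)
    rw [sub_add_sub_cancel] at this
    linarith
  · refine (quadForm_le_of_abs_sub_le hq' (H' := hessN m z a) (η := K * ρ) (fun k l => ?_) v).trans ?_
    · rw [← hess_fullObj fun i => hm_smooth _ _ ha]
      exact (hlip a ha k l).trans (by gcongr)
    · have : 0 ≤ ‖v‖ ^ 2 := by positivity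
      nlinarith
  · have hterm : ∀ i, hess (m (z i)) a k l ^ 2 ≤
        2 * hess (m (z i)) θ₀ k l ^ 2 + 2 * ρ ^ 2 * ψ (z i) ^ 2 := fun i => by
      have h4 := (hH_lip (z i) a ha θ₀ hθ₀ k l).trans
        (mul_le_mul_of_nonneg_right (le_abs_self _) (norm_nonneg _))
      have h5 : |hess (m (z i)) a k l - hess (m (z i)) θ₀ k l| ≤ |ψ (z i)| * ρ :=
        h4.trans (by gcongr)
      have h6 := sq_le_sq' (abs_le.1 h5).1 (abs_le.1 h5).2
      rw [mul_pow, sq_abs] at h6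
      nlinarith [sq_nonneg (hess (m (z i)) a k l - 2 * hess (m (z i)) θ₀ k l)]
    calc _ ≤ (n : ℝ)⁻¹ * ∑ i, (2 * hess (m (z i)) θ₀ k l ^ 2 + 2 * ρ ^ 2 * ψ (z i) ^ 2) := by
          gcongr with i; exact hterm i
      _ = 2 * ((n : ℝ)⁻¹ * ∑ i, hess (m (z i)) θ₀ k l ^ 2) +
          2 * ρ ^ 2 * ((n : ℝ)⁻¹ * ∑ i, ψ (z i) ^ 2) := by
          rw [Finset.sum_add_distrib, ← Finset.mul_sum, ← Finset.mul_sum]; ring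
      _ ≤ _ := by
          have := hz.hess2 k l
          have := hz.lip2
          gcongr

variable {Ω : Type*} [MeasurableSpace Ω] [MeasurableSpace 𝒵] {P : Measure Ω}
  [IsProbabilityMeasure P] {Z : ℕ → Ω → 𝒵}

/-- By the law of large numbers, the data are typical with probability tending to one. -/
theorem tendsto_measure_not_typicalSample (hm_meas : ∀ θ, Measurable fun z => m z θ)
    (hZ_meas : ∀ i, Measurable (Z i))
    (hZ_indep : iIndepFun Z P) (hZ_ident : ∀ i, IdentDistrib (Z i) (Z 0) P P)
    (hm_smooth : ∀ z, ∀ θ ∈ Θ, ContDiffAt ℝ 2 (m z) θ) {θ₀ : EuclideanSpace ℝ (Fin d)} {r : ℝ}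
    (hr : 0 < r) (hball : Metric.closedBall θ₀ r ⊆ Θ)
    (hH_sq : ∀ k l, MemLp (fun ω => hess (m (Z 0 ω)) θ₀ k l) 2 P)
    (hψ_meas : Measurable ψ) (hψ_sq : MemLp (fun ω => ψ (Z 0 ω)) 2 P)
    (hG_sq : ∀ k, MemLp (fun ω => grad (m (Z 0 ω)) θ₀ k) 2 P)
    (hG_zero : ∀ k, ∫ ω, grad (m (Z 0 ω)) θ₀ k ∂P = 0) :
    ∃ K : ℝ, 0 ≤ K ∧ ∀ η : ℝ, 0 < η → Tendsto (fun n => P {ω | ¬ TypicalSample m ψ θ₀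
      (Matrix.of fun k l => ∫ ω, hess (m (Z 0 ω)) θ₀ k l ∂P) η K (dataSet Z n ω)}) atTop (𝓝 0) := by
  have hθ₀ : θ₀ ∈ Θ := hball (Metric.mem_closedBall_self hr.le)
  have hGm := measurable_grad hm_meas hm_smooth hθ₀
  have hHm := measurable_hess hm_meas hm_smooth hr hball
  set K₁ := ∫ ω, |ψ (Z 0 ω)| ∂P with hK₁
  set K₂ := ∫ ω, ψ (Z 0 ω) ^ 2 ∂P with hK₂
  set K₃ : Fin d → Fin d → ℝ := fun k l => ∫ ω, hess (m (Z 0 ω)) θ₀ k l ^ 2 ∂P with hK₃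
  have hK₁0 : 0 ≤ K₁ := integral_nonneg fun ω => abs_nonneg _
  have hK₂0 : 0 ≤ K₂ := integral_nonneg fun ω => sq_nonneg _
  have hK₃0 : ∀ k l, 0 ≤ K₃ k l := fun k l => integral_nonneg fun ω => sq_nonneg _
  have hK₃s : ∀ k l, K₃ k l ≤ ∑ k, ∑ l, K₃ k l := fun k l =>
    (Finset.single_le_sum (f := K₃ k) (fun l _ => hK₃0 k l) (Finset.mem_univ l)).trans
      (Finset.single_le_sum (f := fun k => ∑ l, K₃ k l)
        (fun k _ => Finset.sum_nonneg fun l _ => hK₃0 k l) (Finset.mem_univ k))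
  have hK₃s0 : 0 ≤ ∑ k, ∑ l, K₃ k l :=
    Finset.sum_nonneg fun k _ => Finset.sum_nonneg fun l _ => hK₃0 k l
  refine ⟨K₁ + K₂ + ∑ k, ∑ l, K₃ k l + 1, by positivity, fun η hη => ?_⟩
  have hlln := fun (φ : 𝒵 → ℝ) (hφ : Measurable φ) (hint : Integrable (fun ω => φ (Z 0 ω)) P)
    (δ : ℝ) (hδ : 0 < δ) => tendsto_measure_abs_avg_sub_ge hZ_meas hZ_indep hZ_ident hφ hint hδ
  have hA := tendsto_measure_iUnion_zero fun k =>
    hlln _ (hGm k) ((hG_sq k).integrable one_le_two) η hη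
  have hB := tendsto_measure_iUnion_zero fun k => tendsto_measure_iUnion_zero fun l =>
    hlln _ (hHm k l) ((hH_sq k l).integrable one_le_two) η hη
  have hC := hlln (fun z => |ψ z|) hψ_meas.abs (hψ_sq.integrable one_le_two).abs 1 one_pos
  have hD := hlln (fun z => ψ z ^ 2) (hψ_meas.pow_const 2) hψ_sq.integrable_sq 1 one_pos
  have hE := tendsto_measure_iUnion_zero fun k => tendsto_measure_iUnion_zero fun l =>
    hlln (fun z => hess (m z) θ₀ k l ^ 2) ((hHm k l).pow_const 2) (hH_sq k l).integrable_sq 1 one_pos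
  refine tendsto_of_tendsto_of_tendsto_of_le_of_le tendsto_const_nhds
    (tendsto_measure_union_zero (tendsto_measure_union_zero (tendsto_measure_union_zero
      (tendsto_measure_union_zero hA hB) hC) hD) hE) (fun _ => zero_le)
    fun n => measure_mono fun ω hω => ?_
  by_contra hcon
  simp only [Set.mem_union, Set.mem_iUnion, Set.mem_ofPred_eq, not_or, not_exists, not_le] at hcon
  obtain ⟨⟨⟨⟨h1, h2⟩, h3⟩, h4⟩, h5⟩ := hcon
  refine hω ⟨fun k => ?_, fun k l => (h2 k l).le, ?_, ?_, fun k l => ?_⟩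
  · have := h1 k
    rw [hG_zero k, sub_zero] at this
    exact this.le
  · linarith [(abs_lt.1 h3).2]
  · linarith [(abs_lt.1 h4).2]
  · linarith [(abs_lt.1 (h5 k l)).2, hK₃s k l]

/-- The data are regular at the full-data estimator with probability arbitrarily close to one, for
suitable constants. -/
theorem regularSample_in_probability (hm_meas : ∀ θ, Measurable fun z => m z θ)
    (hZ_meas : ∀ i, Measurable (Z i))
    (hZ_indep : iIndepFun Z P) (hZ_ident : ∀ i, IdentDistrib (Z i) (Z 0) P P)
    (hm_conc : ∀ z, ConcaveOn ℝ (convexHull ℝ Θ) (m z))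
    (hm_sq : ∀ θ ∈ Θ, MemLp (fun ω => m (Z 0 ω) θ) 2 P)
    {θ₀ : EuclideanSpace ℝ (Fin d)} (hθ₀ : θ₀ ∈ interior Θ)
    (hθ₀_max : ∀ θ ∈ Θ, θ ≠ θ₀ → ∫ ω, m (Z 0 ω) θ ∂P < ∫ ω, m (Z 0 ω) θ₀ ∂P)
    (hm_smooth : ∀ z, ∀ θ ∈ Θ, ContDiffAt ℝ 2 (m z) θ)
    (hH_sq : ∀ k l, MemLp (fun ω => hess (m (Z 0 ω)) θ₀ k l) 2 P)
    (hH_pos : (-(Matrix.of fun k l => ∫ ω, hess (m (Z 0 ω)) θ₀ k l ∂P) :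
      Matrix (Fin d) (Fin d) ℝ).PosDef)
    (hψ_meas : Measurable ψ) (hψ_sq : MemLp (fun ω => ψ (Z 0 ω)) 2 P)
    (hH_lip : ∀ z, ∀ θ₁ ∈ Θ, ∀ θ₂ ∈ Θ, ∀ k l,
      |hess (m z) θ₁ k l - hess (m z) θ₂ k l| ≤ ψ z * ‖θ₁ - θ₂‖)
    (hG_sq : ∀ k, MemLp (fun ω => grad (m (Z 0 ω)) θ₀ k) 2 P)
    {θhat : (n : ℕ) → (Fin n → 𝒵) → EuclideanSpace ℝ (Fin d)}
    (hθhat_mem : ∀ n z, θhat n z ∈ Θ) (hθhat_max : ∀ n z, IsMaxOn (fullObj m z) Θ (θhat n z))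
    (hG_four : BoundedInProb P fun n ω => (n : ℝ)⁻¹ * ∑ i : Fin n,
      ‖WithLp.toLp 2 (grad (m (Z i ω)) (θhat n (dataSet Z n ω)))‖ ^ 4)
    {s : ℕ → ℝ} {prb : (n : ℕ) → (Fin n → 𝒵) → Fin n → ℝ}
    (hp_min : BoundedInProb P fun n ω => ⨆ i : Fin n, ((n : ℝ) * prb n (dataSet Z n ω) i)⁻¹)
    (h_nondeg : BoundedBelowInProb P fun n ω =>
      lamP m (s n) (dataSet Z n ω) (prb n (dataSet Z n ω)) (θhat n (dataSet Z n ω)))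
    {ε : ℝ} (hε : 0 < ε) :
    ∃ K c lam r : ℝ, 0 ≤ K ∧ 0 < c ∧ 0 < lam ∧ 0 < r ∧ ∀ᶠ n in atTop,
      P {ω | ¬ RegularSample m Θ ψ K c lam r (s n) (dataSet Z n ω) (prb n (dataSet Z n ω))
        (θhat n (dataSet Z n ω))} ≤ ENNReal.ofReal ε := by
  obtain ⟨r, hr, hball⟩ : ∃ r : ℝ, 0 < r ∧ Metric.closedBall θ₀ r ⊆ Θ :=
    Metric.nhds_basis_closedBall.mem_iff.1 (mem_interior_iff_mem_nhds.1 hθ₀)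
  have hG_zero := integral_grad_eq_zero hm_smooth hH_lip (X := Z 0) hr hball
    (fun θ hθ => (hm_sq θ hθ).integrable one_le_two)
    (fun θ hθ => by
      by_cases h : θ = θ₀
      · rw [h]
      · exact (hθ₀_max θ hθ h).le)
    (fun k => (hG_sq k).integrable one_le_two) (fun k l => (hH_sq k l).integrable one_le_two)
    (hψ_sq.integrable one_le_two)
  obtain ⟨K₀, hK₀, htyp⟩ := tendsto_measure_not_typicalSample hm_meas hZ_meas hZ_indep hZ_ident
    hm_smooth hr hball hH_sq hψ_meas hψ_sq hG_sq hG_zero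
  obtain ⟨lam, hlam, hquad⟩ := exists_quadForm_le_of_neg_posDef hH_pos
  obtain ⟨K₁, hK₁⟩ := hG_four (ε / 4) (by positivity)
  obtain ⟨K₂, hK₂⟩ := hp_min (ε / 4) (by positivity)
  obtain ⟨c, hc, hc'⟩ := h_nondeg (ε / 4) (by positivity)
  -- `ρ` is the distance up to which the curvature at `θ₀` persists, and `η` the accuracy of the
  -- empirical means that forces the estimator into the ball of radius `ρ`
  set ρ : ℝ := min (r / 3) (lam / (4 * (d ^ 2 * K₀ + 1))) with hρdef
  have hρ : 0 < ρ := by positivity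
  have hρr : 2 * ρ < r := by
    have : ρ ≤ r / 3 := min_le_left _ _
    linarith
  have hρ2 : 4 * (d ^ 2 * K₀ * ρ) ≤ lam := by
    have h1 : ρ ≤ lam / (4 * (d ^ 2 * K₀ + 1)) := min_le_right _ _
    rw [le_div_iff₀ (by positivity)] at h1
    nlinarith
  set η : ℝ := min (lam * ρ / (4 * (d + 1))) (lam / (2 * (d ^ 2 + 1))) with hηdef
  have hη : 0 < η := by positivity
  have hη1 : 2 * (d * η) < lam / 2 * ρ := by
    have h1 : η ≤ lam * ρ / (4 * (d + 1)) := min_le_left _ _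
    rw [le_div_iff₀ (by positivity)] at h1
    linarith
  have hη2 : 2 * (d ^ 2 * η) ≤ lam := by
    have h1 : η ≤ lam / (2 * (d ^ 2 + 1)) := min_le_right _ _
    rw [le_div_iff₀ (by positivity)] at h1
    linarith
  refine ⟨|K₁| + |K₂| + K₀ + (2 * K₀ + 2 * ρ ^ 2 * K₀), c, lam / 4, ρ, by positivity, hc,
    by positivity, hρ, ?_⟩
  have htyp' : ∀ᶠ n in atTop, P {ω | ¬ TypicalSample m ψ θ₀
      (Matrix.of fun k l => ∫ ω, hess (m (Z 0 ω)) θ₀ k l ∂P) η K₀ (dataSet Z n ω)} ≤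
        ENNReal.ofReal (ε / 4) :=
    (htyp η hη).eventually_le_const (ENNReal.ofReal_pos.2 (by positivity))
  filter_upwards [htyp', hK₁, hK₂, hc'] with n h1 h2 h3 h4
  have e : ENNReal.ofReal ε = ENNReal.ofReal (ε / 4) + ENNReal.ofReal (ε / 4) +
      ENNReal.ofReal (ε / 4) + ENNReal.ofReal (ε / 4) := by
    rw [← ENNReal.ofReal_add, ← ENNReal.ofReal_add, ← ENNReal.ofReal_add] <;> first
      | positivity
      | (congr 1; ring)
  rw [e]
  refine le_trans (measure_mono ?_) ((measure_union_le _ _).trans (add_le_add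
    ((measure_union_le _ _).trans (add_le_add ((measure_union_le _ _).trans
      (add_le_add h1 h2)) h3)) h4))
  intro ω hω
  by_contra hcon
  simp only [Set.mem_union, Set.mem_ofPred_eq, not_or, not_not, not_lt] at hcon
  obtain ⟨⟨⟨hz, hg⟩, hw⟩, hl⟩ := hcon
  obtain ⟨b1, b2, b3⟩ := hz.bounds hm_conc hm_smooth hH_lip hball hK₀ hquad
    (hθhat_mem n (dataSet Z n ω)) (hθhat_max n (dataSet Z n ω)) hρ hρr hη1 hρ2 hη2
  have hK₁a := le_abs_self K₁
  have hK₂a := le_abs_self K₂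
  have hK₁0 := abs_nonneg K₁
  have hK₂0 := abs_nonneg K₂
  have hρK : 0 ≤ 2 * ρ ^ 2 * K₀ := by positivity
  refine hω ⟨b1, b2, hl, fun i => ?_, ?_, fun k l => (b3 k l).trans ?_, hz.lip.trans ?_⟩
  · have h5 := le_ciSup (f := fun i : Fin n => ((n : ℝ) * prb n (dataSet Z n ω) i)⁻¹)
      (Set.finite_range _).bddAbove i
    have h6 := (le_abs_self _).trans hw
    linarith
  · have h6 := (le_abs_self _).trans hg
    change (n : ℝ)⁻¹ * ∑ i : Fin n,
      ‖WithLp.toLp 2 (grad (m (Z i ω)) (θhat n (dataSet Z n ω)))‖ ^ 4 ≤ _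
    linarith
  · linarith
  · linarith

end RegularityInProbability

/-! ### Conditional asymptotic normality of the Poisson subsampling estimator -/

theorem theorem2 {Ω 𝒵 : Type*} [MeasurableSpace Ω] [MeasurableSpace 𝒵]
    (P : Measure Ω) [IsProbabilityMeasure P] {d : ℕ}
    -- the objective function `m(z, θ)` and the parameter set
    (m : 𝒵 → EuclideanSpace ℝ (Fin d) → ℝ) (hm_meas : ∀ θ, Measurable fun z => m z θ)
    (Θ : Set (EuclideanSpace ℝ (Fin d)))
    -- the observations are independent and identically distributed
    (Z : ℕ → Ω → 𝒵) (hZ_meas : ∀ i, Measurable (Z i)) (hZ_indep : iIndepFun Z P)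
    (hZ_ident : ∀ i, IdentDistrib (Z i) (Z 0) P P)
    -- compact parameter set, concave objective with finite second moment, unique maximum of the
    -- expected objective, attained at an interior point
    (hΘ : IsCompact Θ)
    (hm_conc : ∀ z, ConcaveOn ℝ (convexHull ℝ Θ) (m z))
    (hm_sq : ∀ θ ∈ Θ, MemLp (fun ω => m (Z 0 ω) θ) 2 P)
    (θ₀ : EuclideanSpace ℝ (Fin d)) (hθ₀ : θ₀ ∈ interior Θ)
    (hθ₀_max : ∀ θ ∈ Θ, θ ≠ θ₀ → ∫ ω, m (Z 0 ω) θ ∂P < ∫ ω, m (Z 0 ω) θ₀ ∂P)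
    -- smoothness and conditions on the Hessian
    (hm_smooth : ∀ z, ∀ θ ∈ Θ, ContDiffAt ℝ 2 (m z) θ)
    (hH_sq : ∀ θ ∈ Θ, ∀ k l, MemLp (fun ω => hess (m (Z 0 ω)) θ k l) 2 P)
    (hH_pos : (-(Matrix.of fun k l => ∫ ω, hess (m (Z 0 ω)) θ₀ k l ∂P) :
      Matrix (Fin d) (Fin d) ℝ).PosDef)
    (ψ : 𝒵 → ℝ) (hψ_meas : Measurable ψ) (hψ_sq : MemLp (fun ω => ψ (Z 0 ω)) 2 P)
    (hH_lip : ∀ z, ∀ θ₁ ∈ Θ, ∀ θ₂ ∈ Θ, ∀ k l,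
      |hess (m z) θ₁ k l - hess (m z) θ₂ k l| ≤ ψ z * ‖θ₁ - θ₂‖)
    -- the full-data estimator
    (θhat : (n : ℕ) → (Fin n → 𝒵) → EuclideanSpace ℝ (Fin d))
    (hθhat_meas : ∀ n, Measurable (θhat n))
    (hθhat_mem : ∀ n z, θhat n z ∈ Θ)
    (hθhat_max : ∀ n z, IsMaxOn (fullObj m z) Θ (θhat n z))
    -- conditions on the gradient
    (hG_sq : ∀ k, MemLp (fun ω => grad (m (Z 0 ω)) θ₀ k) 2 P)
    (hG_pos : (Matrix.of fun k l => ∫ ω, grad (m (Z 0 ω)) θ₀ k * grad (m (Z 0 ω)) θ₀ l ∂P :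
      Matrix (Fin d) (Fin d) ℝ).PosDef)
    (hG_four : BoundedInProb P fun n ω => (n : ℝ)⁻¹ * ∑ i : Fin n,
      ‖WithLp.toLp 2 (grad (m (Z i ω)) (θhat n (dataSet Z n ω)))‖ ^ 4)
    -- expected subsample sizes and data-dependent subsampling probabilities
    (s : ℕ → ℝ) (hs_range : ∀ n, 1 ≤ n → 0 ≤ s n ∧ s n < n) (hs : Tendsto s atTop atTop)
    (prb : (n : ℕ) → (Fin n → 𝒵) → Fin n → ℝ)
    (hp_meas : ∀ n, Measurable (prb n))
    (hp_pos : ∀ n z i, 0 < prb n z i)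
    (hp_sum : ∀ n, 1 ≤ n → ∀ z, ∑ i, prb n z i = 1)
    (hp_le : ∀ n z i, s n * prb n z i ≤ 1)
    (hp_min : BoundedInProb P fun n ω => ⨆ i : Fin n, ((n : ℝ) * prb n (dataSet Z n ω) i)⁻¹)
    -- the asymptotic variance does not degenerate
    (h_nondeg : BoundedBelowInProb P fun n ω =>
      lamP m (s n) (dataSet Z n ω) (prb n (dataSet Z n ω)) (θhat n (dataSet Z n ω)))
    -- the Poisson subsampling estimator, a function of the data and of the selected indices
    (θtil : (n : ℕ) → (Fin n → 𝒵) → Finset (Fin n) → EuclideanSpace ℝ (Fin d))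
    (hθtil_meas : ∀ n S, Measurable fun z => θtil n z S)
    (hθtil_mem : ∀ n z S, θtil n z S ∈ Θ)
    (hθtil_max : ∀ n z S, IsMaxOn (subObj m z (prb n z) S) Θ (θtil n z S)) :
    -- conditional asymptotic normality given the data, in probability
    (∀ x : Fin d → ℝ, TendstoInMeasure P
      (fun n ω => condProb (s n) (prb n (dataSet Z n ω))
        {S | ∀ k, normErr m (s n) (dataSet Z n ω) (prb n (dataSet Z n ω))
          (θhat n (dataSet Z n ω)) (θtil n (dataSet Z n ω) S) k ≤ x k})
      atTop
      (fun _ => (stdGaussian (EuclideanSpace ℝ (Fin d))).real {y | ∀ k, y k ≤ x k})) ∧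
    -- with probability tending to one, the variance is positive definite and strictly smaller
    -- than the one of sampling with replacement
    Tendsto (fun n => P {ω | ¬
      ((varP m (s n) (dataSet Z n ω) (prb n (dataSet Z n ω)) (θhat n (dataSet Z n ω))).PosDef ∧
      (varR m (dataSet Z n ω) (prb n (dataSet Z n ω)) (θhat n (dataSet Z n ω)) -
        varP m (s n) (dataSet Z n ω) (prb n (dataSet Z n ω))
          (θhat n (dataSet Z n ω))).PosDef)}) atTop (𝓝 0) ∧
    -- and it is never larger, in the Loewner order
    (∀ n, 1 ≤ n → ∀ (z : Fin n → 𝒵), ∀ θ ∈ Θ,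
      (lamR m z (prb n z) θ - lamP m (s n) z (prb n z) θ).PosSemidef ∧
      (varR m z (prb n z) θ - varP m (s n) z (prb n z) θ).PosSemidef) := by
  have hsmooth_hat : ∀ (n : ℕ) (z : Fin n → 𝒵), ∀ θ ∈ Θ, ∀ i, ContDiffAt ℝ 2 (m (z i)) θ :=
    fun n z θ hθ i => hm_smooth _ _ hθ
  have hθ₀Θ : θ₀ ∈ Θ := interior_subset hθ₀
  have hreg := fun (ε : ℝ) (hε : 0 < ε) => regularSample_in_probability hm_meas hZ_meas hZ_indep
    hZ_ident hm_conc hm_sq hθ₀ hθ₀_max hm_smooth (hH_sq θ₀ hθ₀Θ) hH_pos hψ_meas hψ_sq hH_lip hG_sq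
    hθhat_mem hθhat_max hG_four (s := s) hp_min h_nondeg hε
  -- it suffices to bound the events by the complement of the regularity event
  have hsuff : ∀ A : ℕ → Set Ω, (∀ K c lam r : ℝ, 0 ≤ K → 0 < c → 0 < lam → 0 < r →
      ∀ᶠ n in atTop, ∀ ω, RegularSample m Θ ψ K c lam r (s n) (dataSet Z n ω)
        (prb n (dataSet Z n ω)) (θhat n (dataSet Z n ω)) → ω ∉ A n) →
      Tendsto (fun n => P (A n)) atTop (𝓝 0) := by
    intro A hA
    rw [ENNReal.tendsto_nhds_zero]
    intro ε hε
    obtain ⟨ε', hε', hle⟩ : ∃ ε' : ℝ, 0 < ε' ∧ ENNReal.ofReal ε' ≤ ε := by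
      rcases eq_or_ne ε ⊤ with rfl | h
      · exact ⟨1, one_pos, le_top⟩
      · exact ⟨ε.toReal, ENNReal.toReal_pos hε.ne' h, (ENNReal.ofReal_toReal h).le⟩
    obtain ⟨K, c, lam, r, hK, hc, hlam, hr, hev⟩ := hreg ε' hε'
    filter_upwards [hev, hA K c lam r hK hc hlam hr] with n h1 h2
    exact (measure_mono fun ω hω hgood => h2 ω hgood hω).trans (h1.trans hle)
  refine ⟨fun x => ?_, ?_, fun n hn z θ hθ => ?_⟩
  · rw [tendstoInMeasure_iff_dist]
    intro δ hδ
    refine hsuff _ fun K c lam r hK hc hlam hr => ?_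
    obtain ⟨N, hN⟩ := condProb_tendsto hm_conc hm_smooth hH_lip hK hc hlam hr x hδ
    filter_upwards [hs.eventually_ge_atTop N] with n hn ω hω hbad
    have := hN (s n) hn n (dataSet Z n ω) (prb n (dataSet Z n ω)) (θhat n (dataSet Z n ω))
      (θtil n (dataSet Z n ω)) (hp_pos _ _) (hp_le _ _) hω (hθhat_max _ _) (hθtil_mem _ _)
      (hθtil_max _ _)
    exact absurd this (not_lt.2 hbad)
  · refine hsuff _ fun K c lam r hK hc hlam hr => ?_
    filter_upwards [hs.eventually_gt_atTop 0, eventually_ge_atTop 1] with n hsn hn ω hω hbad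
    have hΛ := posDef_of_sub_smul_one hc hω.lam_ge
    have hu := isUnit_of_quadForm_neg hlam hω.quad
    have hH := hessN_isHermitian m
      (hsmooth_hat n (dataSet Z n ω) _ (hθhat_mem n (dataSet Z n ω)))
    refine hbad ⟨posDef_inv_mul_mul_inv hH hu hΛ, ?_⟩
    rw [varR_sub_varP]
    exact posDef_inv_mul_mul_inv hH hu (lamR_sub_lamP_posDef m hsn hn hΛ)
  · have h := lamR_sub_lamP_posSemidef m (hs_range n hn).1 z (prb n z) θ
    refine ⟨h, ?_⟩
    rw [varR_sub_varP]
    exact posSemidef_inv_mul_mul_inv (hessN_isHermitian m (hsmooth_hat n z θ hθ)) h
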